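/- Let $n\ge 0$ be an integer and let $\rho=[n-1,\dots,1,0]$ be the staircase partition. Let the operator $s_i$ exchange the variables $x_i,x_{i+1}$ in polynomials in $\mathbb{Q}[x_1,\dots,x_{2n}]$. For partitions $\lambda,\mu$ whose diagrams are contained in that of $\rho$ (written $\lambda,\mu\le\rho$), define: (a) Label each box of $\lambda$ by a pair $[i,k]$. The first label $i$ is $n+c-r$ for the box in row $r$ and column $c$ (so it is $n$ in the first box, increases by $1$ when moving right and decreases by $1$ when moving down). The second label $k$ is $0$ for the corners of $\lambda$, $1$ for the corners of the diagram obtained by erasing these corners, and so on. Read the boxes of $\lambda$ row by row, starting with the first (longest) row, each row from left to right. The polynomial $KL^\Delta_\lambda$ is obtained from $$KL^\Delta_0=\prod_{1\le i<j\le n}(x_i-x_j)\prod_{n+1\le i<j\le 2n}(x_i-x_j)$$ by applying successively, in this reading order, the operators $s_i-\frac1{1+k}$ attached to the boxes $[i,k]$. (b) Write $\mu=[\mu_1\ge\dots\ge\mu_n]$. The Dyck path of $\mu$ has $2n$ steps; its increasing steps are those in the positions $i+\mu_{n+1-i}$, $1\le i\le n$, and the other steps are decreasing. Pair increasing and decreasing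 steps like opening and closing parentheses. The vector $\psi(\mu)\in\mathbb{Z}^{2n}$ is obtained by labelling the successive increasing steps $0,2,\dots,2n-2$ and each decreasing step by the label of the step with which it is paired. Then for all $\lambda,\mu\le\rho$ the value of $KL^\Delta_\lambda$ at $(x_1,\dots,x_{2n})=\psi(\mu)$ is $$KL^\Delta_\lambda(\psi(\mu))=(-1)^{|\rho|-|\lambda|}\,c_n\,\delta_{\lambda\mu},\qquad c_n=\prod_{1\le i<j\le n}(2i-2j)^2 .$$ -/

import Mathlib

noncomputable section

namespace KLInterp

open MvPolynomial

/-- The staircase partition `ρ = [n-1, …, 1, 0]`, as a Young diagram. Rows and columns are counted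
from `0`, so that row `i` has the `n - 1 - i` boxes `(i, j)` with `i + j + 1 < n`. -/
def staircase (n : ℕ) : YoungDiagram where
  cells := (Finset.range n ×ˢ Finset.range n).filter fun c => c.1 + c.2 + 1 < n
  isLowerSet := by
    rintro ⟨a, b⟩ ⟨a', b'⟩ h hab
    obtain ⟨h1, h2⟩ := Prod.mk_le_mk.1 h
    simp only [Finset.mem_coe, Finset.mem_filter, Finset.mem_product, Finset.mem_range] at hab ⊢
    omega

/-- The box `c` is a corner of the diagram `lam`: it lies in `lam`, but neither the box below it
nor the box to its right does. -/
def IsCorner (lam : YoungDiagram) (c : ℕ × ℕ) : Prop :=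
  c ∈ lam ∧ (c.1 + 1, c.2) ∉ lam ∧ (c.1, c.2 + 1) ∉ lam

open Classical in
/-- The diagram obtained from `lam` by erasing all its corners simultaneously. -/
def eraseCorners (lam : YoungDiagram) : YoungDiagram where
  cells := lam.cells.filter fun c => ¬ IsCorner lam c
  isLowerSet := by
    rintro ⟨a, b⟩ ⟨a', b'⟩ h hab
    obtain ⟨h1, h2⟩ := Prod.mk_le_mk.1 h
    rw [Finset.mem_coe, Finset.mem_filter, YoungDiagram.mem_cells] at hab ⊢
    obtain ⟨hm, hc⟩ := hab
    refine ⟨lam.up_left_mem h1 h2 hm, ?_⟩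
    rintro ⟨-, hd, hr⟩
    rcases Nat.lt_or_ge a' a with ha | ha
    · exact hd (lam.up_left_mem ha h2 hm)
    rcases Nat.lt_or_ge b' b with hb | hb
    · exact hr (lam.up_left_mem h1 hb hm)
    obtain rfl : a = a' := le_antisymm ha h1
    obtain rfl : b = b' := le_antisymm hb h2
    exact hc ⟨hm, hd, hr⟩

/-- The second label of a box `c` of `lam`: `0` for the corners of `lam`, `1` for the new corners
obtained after erasing these, `2` for the next ones, and so on. -/
def level (lam : YoungDiagram) (c : ℕ × ℕ) : ℕ :=
  sInf {k | IsCorner (eraseCorners^[k] lam) c}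

/-- The first label of a box: `n` in the first box, increasing by `1` with each step to the right
and decreasing by `1` with each step down. (No truncation for boxes of diagrams with at most `n`
rows.) -/
def content (n : ℕ) (c : ℕ × ℕ) : ℕ := n + c.2 - c.1

/-- The boxes of `lam`, row after row starting with the first (longest) row, each row from left
to right. -/
def rowReading (lam : YoungDiagram) : List (ℕ × ℕ) :=
  (List.range (lam.colLen 0)).flatMap fun i => (List.range (lam.rowLen i)).map fun j => (i, j)

/-- The Vandermonde product `∏_{a ≤ i < j ≤ b} (x_i - x_j)`. The variables are `x_1, x_2, …`;
only `x_1, …, x_{2n}` occur below. -/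
def vandermonde (a b : ℕ) : MvPolynomial ℕ ℚ :=
  ∏ i ∈ Finset.Icc a b, ∏ j ∈ Finset.Ioc i b, (X i - X j)

/-- The operator `s_i - (1 + k)⁻¹`, where `s_i` exchanges the variables `x_i` and `x_{i+1}`. -/
def boxOperator (i k : ℕ) (f : MvPolynomial ℕ ℚ) : MvPolynomial ℕ ℚ :=
  rename (Equiv.swap i (i + 1)) f - C (1 + (k : ℚ))⁻¹ * f

/-- The Kazhdan–Lusztig polynomial of `lam`: start with the product of the Vandermonde products
in `x_1, …, x_n` and in `x_{n+1}, …, x_{2n}`, and apply the operators attached to the boxes of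
`lam`, in reading order (the operator of the first box is applied first). -/
def KLDelta (n : ℕ) (lam : YoungDiagram) : MvPolynomial ℕ ℚ :=
  (rowReading lam).foldl (fun f c => boxOperator (content n c) (level lam c) f)
    (vandermonde 1 n * vandermonde (n + 1) (2 * n))

/-- The positions of the increasing steps of the Dyck path of `lam = [lam_1 ≥ … ≥ lam_n]`, which
are the numbers `i + lam_{n+1-i}` for `1 ≤ i ≤ n`; they form the bottom row of the standard Young
tableau of `lam`. (`rowLen` counts the parts from `0`, so `lam_{n+1-i}` is `lam.rowLen (n - i)`.) -/
def upPositions (n : ℕ) (lam : YoungDiagram) : Finset ℕ :=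
  (Finset.Icc 1 n).image fun i => i + lam.rowLen (n - i)

/-- The Dyck path of `lam`, as the list of its steps `1, …, 2n`. -/
def dyckPath (n : ℕ) (lam : YoungDiagram) : List DyckStep :=
  (List.range (2 * n)).map fun p => if p + 1 ∈ upPositions n lam then DyckStep.U else DyckStep.D

/-- Labels of the steps of a path. Here `k` is the number of increasing steps met so far, and
the list `st` holds the labels of those not yet paired, the latest one first. An increasing step
gets the label `2k`; a decreasing step is paired, as with parentheses, with the latest increasing
step not yet paired, and gets its label. The third clause does not occur on Dyck paths. -/
def labelSteps : List DyckStep → ℕ → List ℕ → List ℕ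
  | [], _, _ => []
  | DyckStep.U :: w, k, st => (2 * k) :: labelSteps w (k + 1) ((2 * k) :: st)
  | DyckStep.D :: w, k, [] => 0 :: labelSteps w k []
  | DyckStep.D :: w, k, a :: st => a :: labelSteps w k st

/-- The vector `ψ(lam)`, of length `2n`. -/
def psi (n : ℕ) (lam : YoungDiagram) : List ℕ := labelSteps (dyckPath n lam) 0 []

/-- The value of a polynomial in `x_1, x_2, …` at a vector `v = [v_1, …, v_m]`, that is, at
`x_1 = v_1, …, x_m = v_m` (the other variables, when there are any, are set to `0`). -/
def evalAt (v : List ℕ) (f : MvPolynomial ℕ ℚ) : ℚ :=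
  eval (fun p => if p = 0 then 0 else ((v.getD (p - 1) 0 : ℕ) : ℚ)) f

/-- The constant `c_n = ∏_{1 ≤ i < j ≤ n} (2i - 2j)²`. -/
def constC (n : ℕ) : ℚ :=
  ∏ i ∈ Finset.Icc 1 n, ∏ j ∈ Finset.Ioc i n, (2 * (i : ℚ) - 2 * (j : ℚ)) ^ 2

open Classical in
/-- The Kronecker symbol `δ_{lam, mu}`. -/
def delta (lam mu : YoungDiagram) : ℚ := if lam = mu then 1 else 0

end KLInterp

end

/-! Everything rests on restricting a function of words to the words with two equal letters `a` in
positions `i`, `i + 1` (a cap). The starting product satisfies the three-term relation `Rel`, which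
the operators preserve. Under this relation caps and operators obey Temperley–Lieb type rules. In
particular, across two neighbouring boxes with levels `k + 1` and `k` a cap just moves by one
position, up to a scalar (`cap_tOp_tOp_succ`, `cap_tOp_tOp_pred`): this is what the shifts `1 / (1 +
k)` are made for. At a corner, where `k = 0`, the cap gives zero.

The starting product vanishes at every cap except the middle one, where it becomes the starting
product for `n - 1` times a function symmetric in the remaining letters (`vac_twoBlocks`). Pushing
caps through the boxes of a partition yields: the cap at `p` is zero unless `p` is a peak of the
boundary path, and at a peak it gives the function of the partition with that peak deleted
(`cap_op_of_not_peak`, `exists_cap_op_of_peak`). To make the push possible, a partition is cut at a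
corner farthest from the first box. The levels in the rectangle ending there are distances to that
corner, and the parts below and to the right commute.

The word of `mu` has equal letters at each peak of its path, and deleting them leaves the word of
the smaller path. So one removes a peak of `mu` and inducts on `n` (`ValleyTree.value`), with
arbitrary distinct labels because deletion spoils the sequence `0, 2, 4, …`. Each remaining label
occurs twice, so the symmetric factor is a signed square of differences, and these accumulate to the
constant. -/

namespace KLInterp

/-! ### Operators and caps on functions of words -/

/-- Functions on two-sided rational words. -/
abbrev WordFun := (ℤ → ℚ) → ℚ

/-- The operator `(1 + k)⁻¹ - s_i` on functions of words. -/
def tOp (i : ℤ) (k : ℕ) : WordFun →ₗ[ℚ] WordFun where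
  toFun f w := (1 + (k : ℚ))⁻¹ * f w - f (w ∘ Equiv.swap i (i + 1))
  map_add' f g := by funext w; simp only [Pi.add_apply]; ring
  map_smul' c f := by
    funext w; simp only [Pi.smul_apply, smul_eq_mul, RingHom.id_apply]; ring

/-- Insert two letters `a` in positions `i` and `i + 1`. -/
def ins (i : ℤ) (a : ℚ) (w : ℤ → ℚ) : ℤ → ℚ :=
  fun p => if p < i then w p else if p ≤ i + 1 then a else w (p - 2)

/-- Restriction of a function to the words with letters `a` in positions `i` and `i + 1`. -/
def cap (i : ℤ) (a : ℚ) : WordFun →ₗ[ℚ] WordFun where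
  toFun f w := f (ins i a w)
  map_add' _ _ := rfl
  map_smul' _ _ := rfl

/-- The three-term relation between the values of a function at words that differ by the placement
of two equal letters among three positions of `(lo, hi]`. -/
def Rel (lo hi : ℤ) (f : WordFun) : Prop :=
  ∀ (w : ℤ → ℚ) (p q r : ℤ), p ∈ Set.Ioc lo hi → q ∈ Set.Ioc lo hi → r ∈ Set.Ioc lo hi →
    p ≠ q → p ≠ r → q ≠ r → w p = w q →
    f w + f (w ∘ Equiv.swap q r) + f (w ∘ Equiv.swap p r) = 0

theorem tOp_apply (i : ℤ) (k : ℕ) (f : WordFun) (w : ℤ → ℚ) :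
    tOp i k f w = (1 + (k : ℚ))⁻¹ * f w - f (w ∘ Equiv.swap i (i + 1)) := rfl

theorem cap_apply (i : ℤ) (a : ℚ) (f : WordFun) (w : ℤ → ℚ) : cap i a f w = f (ins i a w) := rfl

/-- Conjugation by the adjacent swap turns an instance of the relation at `p, q, r` into the
instance at their images, which remain in `(lo, hi]`. -/
theorem Rel.tOp {lo hi : ℤ} {f : WordFun} (h : Rel lo hi f) {i : ℤ} (k : ℕ) (h1 : lo < i)
    (h2 : i < hi) : Rel lo hi (tOp i k f) := by
  intro w p q r hp hq hr hpq hpr hqr hw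
  set σ := Equiv.swap i (i + 1) with hσ
  have hmem : ∀ x, x ∈ Set.Ioc lo hi → σ x ∈ Set.Ioc lo hi := by
    intro x hx
    rw [hσ, Equiv.swap_apply_def]
    simp only [Set.mem_Ioc] at hx ⊢
    split_ifs <;> omega
  have hinv : ∀ x, σ (σ x) = x := fun x => by simp [hσ]
  have hsw : ∀ x y, (w ∘ Equiv.swap x y) ∘ σ = (w ∘ σ) ∘ Equiv.swap (σ x) (σ y) := by
    intro x y
    funext z
    simp only [Function.comp_apply]
    congr 1
    have := Equiv.swap_apply_apply σ x y
    rw [this]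
    simp [Equiv.Perm.mul_apply, hσ]
  have e1 := h w p q r hp hq hr hpq hpr hqr hw
  have e2 := h (w ∘ σ) (σ p) (σ q) (σ r) (hmem _ hp) (hmem _ hq) (hmem _ hr)
    (σ.injective.ne hpq) (σ.injective.ne hpr) (σ.injective.ne hqr)
    (by simp only [Function.comp_apply, hinv, hw])
  rw [← hsw, ← hsw] at e2
  simp only [tOp_apply]
  linear_combination (1 + (k : ℚ))⁻¹ * e1 - e2

/-- The swap fixes a word whose two letters agree. The scalar is zero exactly at level `0`, hence
the vanishing at corners. -/
theorem cap_tOp_self (i : ℤ) (a : ℚ) (k : ℕ) (f : WordFun) :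
    cap i a (tOp i k f) = ((1 + (k : ℚ))⁻¹ - 1) • cap i a f := by
  funext w
  have : ins i a w ∘ Equiv.swap i (i + 1) = ins i a w := by
    funext z
    simp only [Function.comp_apply, ins, Equiv.swap_apply_def]
    split_ifs <;> first | rfl | omega
  simp only [Pi.smul_apply, smul_eq_mul, cap_apply, tOp_apply, this]
  ring

/-- The swap separates the equal letters to positions `i` and `i + 2`; the three-term relation on
`i, i + 1, i + 2` expresses that value through the two words where they are adjacent. -/
theorem cap_tOp_succ {lo hi : ℤ} {f : WordFun} (h : Rel lo hi f) {i : ℤ} (a : ℚ) (k : ℕ)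
    (h1 : lo < i) (h2 : i + 1 < hi) :
    cap i a (tOp (i + 1) k f) = (1 + (1 + (k : ℚ))⁻¹) • cap i a f + cap (i + 1) a f := by
  funext w
  have e : ins (i + 1) a w = ins i a w ∘ Equiv.swap i (i + 2) := by
    funext z
    simp only [Function.comp_apply, ins, Equiv.swap_apply_def]
    split_ifs <;> first | rfl | omega | (congr 1; omega)
  have := h (ins i a w) i (i + 1) (i + 2) ⟨by omega, by omega⟩ ⟨by omega, by omega⟩
    ⟨by omega, by omega⟩ (by omega) (by omega) (by omega) (by simp [ins])
  simp only [Pi.add_apply, Pi.smul_apply, smul_eq_mul, cap_apply, tOp_apply, e]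
  rw [show i + 1 + 1 = i + 2 by ring]
  linear_combination - this

theorem cap_tOp_pred {lo hi : ℤ} {f : WordFun} (h : Rel lo hi f) {i : ℤ} (a : ℚ) (k : ℕ)
    (h1 : lo < i) (h2 : i + 1 < hi) :
    cap (i + 1) a (tOp i k f) = (1 + (1 + (k : ℚ))⁻¹) • cap (i + 1) a f + cap i a f := by
  funext w
  have e : ins i a w = ins (i + 1) a w ∘ Equiv.swap (i + 2) i := by
    funext z
    simp only [Function.comp_apply, ins, Equiv.swap_apply_def]
    split_ifs <;> first | rfl | omega | (congr 1; omega)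
  have := h (ins (i + 1) a w) (i + 2) (i + 1) i ⟨by omega, by omega⟩ ⟨by omega, by omega⟩
    ⟨by omega, by omega⟩ (by omega) (by omega) (by omega)
    (by simp only [ins]; split_ifs <;> first | rfl | omega)
  simp only [Pi.add_apply, Pi.smul_apply, smul_eq_mul, cap_apply, tOp_apply, e]
  rw [Equiv.swap_comm i (i + 1)]
  linear_combination - this

theorem cap_tOp_of_lt {i j : ℤ} (a : ℚ) (k : ℕ) (f : WordFun) (h : j + 1 < i) :
    cap i a (tOp j k f) = tOp j k (cap i a f) := by
  funext w
  have e : ins i a w ∘ Equiv.swap j (j + 1) = ins i a (w ∘ Equiv.swap j (j + 1)) := by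
    funext z
    simp only [Function.comp_apply, ins, Equiv.swap_apply_def]
    split_ifs <;> first | rfl | omega
  simp only [cap_apply, tOp_apply, e]

theorem cap_tOp_of_gt {i j : ℤ} (a : ℚ) (k : ℕ) (f : WordFun) (h : i + 1 < j) :
    cap i a (tOp j k f) = tOp (j - 2) k (cap i a f) := by
  funext w
  have e : ins i a w ∘ Equiv.swap j (j + 1) =
      ins i a (w ∘ Equiv.swap (j - 2) (j - 2 + 1)) := by
    funext z
    simp only [Function.comp_apply, ins, Equiv.swap_apply_def]
    split_ifs <;> first | rfl | omega | (congr 1; omega)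
  simp only [cap_apply, tOp_apply, e]

theorem tOp_comm {i j : ℤ} (k l : ℕ) (f : WordFun) (h : i + 1 < j) :
    tOp i k (tOp j l f) = tOp j l (tOp i k f) := by
  funext w
  have e : (w ∘ Equiv.swap i (i + 1)) ∘ Equiv.swap j (j + 1) =
      (w ∘ Equiv.swap j (j + 1)) ∘ Equiv.swap i (i + 1) := by
    funext z
    simp only [Function.comp_apply, Equiv.swap_apply_def]
    split_ifs <;> first | rfl | omega
  simp only [tOp_apply, e]
  ring

/-- Moving a pair of equal letters through two neighbouring boxes of a row. -/
theorem cap_tOp_tOp_succ {lo hi : ℤ} {f : WordFun} (h : Rel lo hi f) {p : ℤ} (a : ℚ) (k : ℕ)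
    (h1 : lo < p) (h2 : p + 1 < hi) :
    cap p a (tOp (p + 1) k (tOp p (k + 1) f)) =
      (1 + (2 + (k : ℚ))⁻¹) • cap (p + 1) a f := by
  -- The terms in `cap p a f` cancel, since `(1 + 1/(1+k)) * (1/(2+k) - 1) = -1`; this needs levels
  -- differing by exactly one.
  rw [cap_tOp_succ (h.tOp (k + 1) h1 (by omega)) a k h1 h2, cap_tOp_self,
    cap_tOp_pred h a (k + 1) h1 h2]
  have e1 : (1 : ℚ) + k ≠ 0 := by positivity
  have e2 : (2 : ℚ) + k ≠ 0 := by positivity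
  have e3 : (1 : ℚ) + (k + 1) ≠ 0 := by positivity
  funext w
  simp only [Pi.add_apply, Pi.smul_apply, smul_eq_mul]
  push_cast
  field_simp
  ring

/-- Moving a pair of equal letters through two neighbouring boxes of a column. -/
theorem cap_tOp_tOp_pred {lo hi : ℤ} {f : WordFun} (h : Rel lo hi f) {p : ℤ} (a : ℚ) (k : ℕ)
    (h1 : lo < p) (h2 : p + 1 < hi) :
    cap (p + 1) a (tOp p k (tOp (p + 1) (k + 1) f)) =
      (1 + (2 + (k : ℚ))⁻¹) • cap p a f := by
  rw [cap_tOp_pred (h.tOp (k + 1) (by omega) h2) a k h1 h2, cap_tOp_self,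
    cap_tOp_succ h a (k + 1) h1 h2]
  have e1 : (1 : ℚ) + k ≠ 0 := by positivity
  have e2 : (2 : ℚ) + k ≠ 0 := by positivity
  have e3 : (1 : ℚ) + (k + 1) ≠ 0 := by positivity
  funext w
  simp only [Pi.add_apply, Pi.smul_apply, smul_eq_mul]
  push_cast
  field_simp
  ring

/-! ### Caps through rows and rectangles -/

/-- The operators of a row of `m` boxes, the first of content `s`, the last of level `k`. -/
def rowOp (s : ℤ) : ℕ → ℕ → WordFun → WordFun
  | 0, _, f => f
  | m + 1, k, f => tOp (s + m) k (rowOp s m (k + 1) f)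

/-- The operators of a rectangle with `r` rows and `c` columns, the first box of content `N`, the
levels being the distances to the last box. -/
def rect : ℤ → ℕ → ℕ → WordFun → WordFun
  | _, 0, _, f => f
  | N, r + 1, c, f => rect (N - 1) r c (rowOp N c r f)

theorem Rel.rowOp {lo hi : ℤ} {f : WordFun} (h : Rel lo hi f) (s : ℤ) (m : ℕ) :
    ∀ k : ℕ, lo < s → s + m ≤ hi → Rel lo hi (rowOp s m k f) := by
  induction m with
  | zero => intro k _ _; exact h
  | succ m ih =>
    intro k h1 h2
    push_cast at h2
    exact (ih (k + 1) h1 (by omega)).tOp k (by omega) (by omega)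

theorem Rel.rect {lo hi : ℤ} (r c : ℕ) :
    ∀ (N : ℤ) {f : WordFun}, Rel lo hi f → lo + r ≤ N → N + c ≤ hi → Rel lo hi (rect N r c f) := by
  induction r with
  | zero => intro N f h _ _; exact h
  | succ r ih =>
    intro N f h h1 h2
    push_cast at h1
    exact ih (N - 1) (h.rowOp N c r (by omega) h2) (by omega) (by omega)

/-- A linear map that moves past the operators `tOp` of a row moves past the row. -/
theorem rowOp_intertwine (A : WordFun →ₗ[ℚ] WordFun) (e s : ℤ) (m : ℕ) (f : WordFun)
    (hA : ∀ j, s ≤ j → j < s + m → ∀ k g, A (tOp j k g) = tOp (j + e) k (A g)) :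
    ∀ k, A (rowOp s m k f) = rowOp (s + e) m k (A f) := by
  induction m with
  | zero => intro k; rfl
  | succ m ih =>
    intro k
    push_cast at hA
    simp only [rowOp]
    rw [hA _ (by omega) (by omega), ih fun j h1 h2 => hA j h1 (by omega)]
    congr 2
    ring

theorem rect_intertwine (A : WordFun →ₗ[ℚ] WordFun) (e : ℤ) (r c : ℕ) :
    ∀ (N : ℤ) (f : WordFun),
      (∀ j, N - r < j → j < N + c → ∀ k g, A (tOp j k g) = tOp (j + e) k (A g)) →
      A (rect N r c f) = rect (N + e) r c (A f) := by
  induction r with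
  | zero => intro N f _; rfl
  | succ r ih =>
    intro N f hA
    push_cast at hA
    simp only [rect]
    rw [ih (N - 1) _ fun j h1 h2 => hA j (by omega) (by omega),
      rowOp_intertwine A e N c f fun j h1 h2 => hA j (by omega) (by omega)]
    congr 1
    ring

theorem tOp_intertwine_of_lt {i j : ℤ} (k : ℕ) (h : j + 1 < i) (l : ℕ) (g : WordFun) :
    tOp i k (tOp j l g) = tOp (j + 0) l (tOp i k g) := by
  rw [add_zero, tOp_comm _ _ _ h]

theorem tOp_intertwine_of_gt {i j : ℤ} (k : ℕ) (h : i + 1 < j) (l : ℕ) (g : WordFun) :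
    tOp i k (tOp j l g) = tOp (j + 0) l (tOp i k g) := by
  rw [add_zero, tOp_comm _ _ _ h]

theorem cap_intertwine_of_lt {i j : ℤ} (a : ℚ) (h : j + 1 < i) (l : ℕ) (g : WordFun) :
    cap i a (tOp j l g) = tOp (j + 0) l (cap i a g) := by
  rw [add_zero, cap_tOp_of_lt _ _ _ h]

theorem cap_intertwine_of_gt {i j : ℤ} (a : ℚ) (h : i + 1 < j) (l : ℕ) (g : WordFun) :
    cap i a (tOp j l g) = tOp (j + -2) l (cap i a g) := by
  rw [cap_tOp_of_gt _ _ _ h]; rfl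

theorem rowOp_zero (s : ℤ) (m : ℕ) : ∀ k, rowOp s m k 0 = 0 := by
  induction m with
  | zero => intro k; rfl
  | succ m ih => intro k; simp [rowOp, ih]

theorem rect_zero (r c : ℕ) : ∀ N : ℤ, rect N r c 0 = 0 := by
  induction r with
  | zero => intro N; rfl
  | succ r ih => intro N; simp [rect, ih, rowOp_zero]

section Row

variable {lo hi : ℤ} {f : WordFun} (a : ℚ)

/-- The boxes of contents `p` and `p + 1` move the cap to `p + 1`, beyond the reach of the earlier
boxes of the row, so it meets `f` itself. -/
theorem cap_rowOp_inner (h : Rel lo hi f) (s p : ℤ) (m : ℕ) (hs : lo < s) (hp : s ≤ p)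
    (hf : cap (p + 1) a f = 0) :
    ∀ k, s + m ≤ hi → p + 1 < s + m → cap p a (rowOp s m k f) = 0 := by
  induction m with
  | zero => intro k _ h2; push_cast at h2; omega
  | succ m ih =>
    intro k h1 h2
    push_cast at h1 h2
    rcases eq_or_ne (p + 1) (s + m) with e | e
    · obtain ⟨m, rfl⟩ : ∃ m', m = m' + 1 := ⟨m - 1, by omega⟩
      push_cast at e h1
      simp only [rowOp]
      rw [show s + ((m + 1 : ℕ) : ℤ) = p + 1 by push_cast; omega, show s + (m : ℤ) = p by omega,
        cap_tOp_tOp_succ (h.rowOp s m (k + 1 + 1) hs (by omega)) a k (by omega) (by omega),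
        rowOp_intertwine _ 0 s m f fun j _ _ => cap_intertwine_of_lt a (by omega), hf, rowOp_zero,
        smul_zero]
    · simp only [rowOp]
      rw [cap_tOp_of_gt _ _ _ (by omega), ih (k + 1) (by omega) (by omega), map_zero]

theorem cap_rowOp_of_gt (s p : ℤ) (m k : ℕ) (hp : s + m < p) :
    cap p a (rowOp s m k f) = rowOp s m k (cap p a f) := by
  rw [rowOp_intertwine _ 0 s m f fun j _ _ => cap_intertwine_of_lt a (by omega), add_zero]

theorem cap_rowOp_of_lt (s p : ℤ) (m k : ℕ) (hp : p + 1 < s) :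
    cap p a (rowOp s m k f) = rowOp (s - 2) m k (cap p a f) := by
  rw [rowOp_intertwine _ (-2) s m f fun j _ _ => cap_intertwine_of_gt a (by omega)]
  rfl

/-- The first box absorbs the cap, moving it from `s - 1` to `s`; the other boxes lie to its right
and shift by two positions. -/
theorem cap_rowOp_left (h : Rel lo hi f) (s : ℤ) (m : ℕ) (hs : lo + 1 < s)
    (hf : cap (s - 1) a f = 0) :
    ∀ k, s + m < hi → cap (s - 1) a (rowOp s (m + 1) k f) = rowOp (s - 1) m k (cap s a f) := by
  induction m with
  | zero =>
    intro k hh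
    push_cast at hh
    have := cap_tOp_succ h (i := s - 1) a k (by omega) (by omega)
    simp only [rowOp]
    simpa [hf] using this
  | succ m ih =>
    intro k hh
    push_cast at hh
    rw [rowOp, cap_tOp_of_gt _ _ _ (by push_cast; omega), ih (k + 1) (by omega)]
    conv_rhs => rw [rowOp]
    congr 2
    push_cast
    ring

/-- Each box moves the cap one step left, and the unwanted term vanishes by `hf`; the whole row is
absorbed. -/
theorem cap_rowOp_right (h : Rel lo hi f) (s : ℤ) (m : ℕ) (hs : lo < s)
    (hf : ∀ j, s < j → j ≤ s + m → cap j a f = 0) :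
    ∀ k, s + m < hi → cap (s + m) a (rowOp s m k f) = cap s a f := by
  induction m with
  | zero => intro k _; simp [rowOp]
  | succ m ih =>
    intro k hh
    push_cast at hh hf
    rw [rowOp, show s + ((m + 1 : ℕ) : ℤ) = s + m + 1 by push_cast; ring,
      cap_tOp_pred (h.rowOp s m (k + 1) hs (by omega)) a k (by omega) (by omega),
      ih (fun j h1 h2 => hf j h1 (by omega)) (k + 1) (by omega),
      cap_rowOp_of_gt a _ _ _ _ (by omega), hf _ (by omega) (by omega), rowOp_zero, smul_zero,
      zero_add]

/-- Two consecutive rows are regrouped into columns of two boxes. Each column moves the cap one step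
left, up to a scalar, until it reaches `f` at `s`. -/
theorem cap_rowOp_rowOp (m : ℕ) :
    ∀ {f : WordFun} (_ : Rel lo hi f) (s : ℤ) (_ : lo < s) (_ : cap s a f = 0)
      (k : ℕ) (_ : s + m < hi),
      cap (s + m) a (rowOp s m k (rowOp (s + 1) m (k + 1) f)) = 0 := by
  induction m with
  | zero => intro f h s hs hf k _; simpa [rowOp] using hf
  | succ m ih =>
    intro f h s hs hf k hh
    push_cast at hh
    simp only [rowOp]
    have e := rowOp_intertwine (tOp (s + 1 + m) (k + 1)) 0 s m (rowOp (s + 1) m (k + 1 + 1) f)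
      (fun j _ _ => tOp_intertwine_of_lt _ (by omega)) (k + 1)
    rw [add_zero] at e
    rw [← e,
      show s + ((m + 1 : ℕ) : ℤ) = s + m + 1 by push_cast; ring,
      show s + 1 + (m : ℤ) = s + m + 1 by ring,
      cap_tOp_tOp_pred ((h.rowOp (s + 1) m (k + 1 + 1) (by omega) (by omega)).rowOp s m (k + 1)
        hs (by omega)) a k (by omega) (by omega), ih h s hs hf (k + 1) (by omega), smul_zero]

end Row

/-- On `(lo, hi)` the function `f` vanishes when two adjacent letters are equal, except that it
restricts to `f'` when the positions are `N` and `N + 1`. -/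
def Vac (N lo hi : ℤ) (a : ℚ) (f f' : WordFun) : Prop :=
  ∀ j, lo < j → j < hi → cap j a f = if j = N then f' else 0

section Rect

variable {lo hi : ℤ} (a : ℚ)

theorem cap_rect_of_gt (N p : ℤ) (r c : ℕ) (f : WordFun) (hp : N + c < p) :
    cap p a (rect N r c f) = rect N r c (cap p a f) := by
  rw [rect_intertwine _ 0 r c N f fun j _ _ => cap_intertwine_of_lt a (by omega), add_zero]

theorem cap_rect_of_lt (N p : ℤ) (r c : ℕ) (f : WordFun) (hp : p < N - r) :
    cap p a (rect N r c f) = rect (N - 2) r c (cap p a f) := by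
  rw [rect_intertwine _ (-2) r c N f fun j _ _ => cap_intertwine_of_gt a (by omega)]
  rfl

/-- The cap meets rows `s` and `s + 1`, counted from `0`, at their right ends; together they carry
it to position `N - (s + 1)` of the input. -/
theorem cap_rect_inner_right (c s : ℕ) :
    ∀ (r : ℕ) (N : ℤ) {f : WordFun} (_ : Rel lo hi f) (_ : s + 1 < r) (_ : lo + r ≤ N)
      (_ : N + c ≤ hi) (_ : cap (N - (s + 1)) a f = 0),
      cap (N + c - (s + 1)) a (rect N r c f) = 0 := by
  induction s with
  | zero =>
    intro r N f h h1 h2 h3 hf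
    obtain ⟨r, rfl⟩ : ∃ r', r = r' + 2 := ⟨r - 2, by omega⟩
    push_cast at h2
    simp only [rect]
    rw [cap_rect_of_gt a _ _ _ _ _ (by push_cast; omega)]
    have := cap_rowOp_rowOp a c h (N - 1) (by omega) (by simpa using hf) r (by omega)
    rw [show N - 1 + 1 = N by ring] at this
    rw [show N + (c : ℤ) - (((0 : ℕ) : ℤ) + 1) = N - 1 + c by push_cast; ring, this, rect_zero]
  | succ s ih =>
    intro r N f h h1 h2 h3 hf
    obtain ⟨r, rfl⟩ : ∃ r', r = r' + 1 := ⟨r - 1, by omega⟩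
    push_cast at h2 hf
    simp only [rect]
    have := ih r (N - 1) (h.rowOp N c r (by omega) h3) (by omega) (by omega) (by omega) (by
      rw [cap_rowOp_of_lt a _ _ _ _ (by omega), show N - 1 - ((s : ℤ) + 1) = N - (s + 1 + 1) by ring,
        hf, rowOp_zero])
    rw [← this]
    congr 2
    push_cast
    ring

/-- Every row moves the cap one step right, so vanishing of the input at `N + (s + 1)` suffices. -/
theorem cap_rect_inner_left (c s : ℕ) (hs : s + 1 < c) :
    ∀ (r : ℕ) (N : ℤ) {f : WordFun} (_ : Rel lo hi f) (_ : lo + r ≤ N)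
      (_ : N + c ≤ hi) (_ : cap (N + (s + 1)) a f = 0),
      cap (N - r + (s + 1)) a (rect N r c f) = 0 := by
  intro r
  induction r with
  | zero => intro N f h h2 h3 hf; simpa [rect] using hf
  | succ r ih =>
    intro N f h h2 h3 hf
    push_cast at h2
    simp only [rect]
    have := ih (N - 1) (h.rowOp N c r (by omega) h3) (by omega) (by omega) (by
      apply cap_rowOp_inner a h N _ c (by omega) (by omega) _ r h3 (by omega)
      rw [← hf]; congr 2; ring)
    rw [← this]
    congr 2
    push_cast
    ring

/-- Each row loses its first box to the cap: altogether the first column disappears and the cap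
arrives at `N`. -/
theorem cap_rect_left (c : ℕ) :
    ∀ (r : ℕ) (N : ℤ) {f : WordFun} (_ : Rel lo hi f) (_ : lo + r < N)
      (_ : N + c < hi) (_ : ∀ q, N - r ≤ q → q < N → cap q a f = 0),
      cap (N - r) a (rect N r (c + 1) f) = rect (N - 1) r c (cap N a f) := by
  intro r
  induction r with
  | zero => intro N f h h2 h3 hf; simp [rect]
  | succ r ih =>
    intro N f h h2 h3 hf
    push_cast at h2 hf
    simp only [rect]
    have := ih (N - 1) (h.rowOp N (c + 1) r (by omega) (by push_cast; omega)) (by omega) (by omega)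
      (by
        intro q h4 h5
        rw [cap_rowOp_of_lt a _ _ _ _ (by omega), hf _ (by omega) (by omega), rowOp_zero])
    rw [cap_rowOp_left a h N c (by omega) (hf _ (by omega) (by omega)) r h3] at this
    rw [← this]
    congr 2
    push_cast
    ring

theorem cap_rect_right {N : ℤ} {f : WordFun} (r c : ℕ) (h : Rel lo hi f) (h1 : lo < N)
    (h2 : N + c < hi) (hf : ∀ q, N < q → q ≤ N + c → cap q a f = 0) :
    cap (N + c) a (rect N (r + 1) c f) = rect (N - 1) r c (cap N a f) := by
  rw [rect, cap_rect_of_gt a _ _ _ _ _ (by omega), cap_rowOp_right a h N c h1 hf r h2]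

/-- The operator applied last has level `0` and acts at the very position of the cap. -/
theorem cap_rect_corner (c : ℕ) :
    ∀ (r : ℕ) (N : ℤ) (f : WordFun), cap (N + c - r) a (rect N (r + 1) (c + 1) f) = 0 := by
  intro r
  induction r with
  | zero =>
    intro N f
    simp only [rect, rowOp]
    rw [show N + (c : ℤ) - ((0 : ℕ) : ℤ) = N + c by simp, cap_tOp_self]
    simp
  | succ r ih =>
    intro N f
    rw [rect, ← ih (N - 1) (rowOp N (c + 1) (r + 1) f)]
    congr 2
    push_cast
    ring

variable {N lo' hi' : ℤ} {f f' : WordFun} {a}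

/-- To the right of its corner, a rectangle again gives a function with a single nonzero cap. This
is the input required by the partition placed there; the restriction loses a row. -/
theorem Vac.rect_right (h : Vac N lo hi a f f') (hr : Rel lo' hi' f) (h1 : lo' ≤ lo)
    (h2 : hi ≤ hi') (r c : ℕ) (h3 : lo + r < N) (h4 : N + c < hi) :
    Vac (N + c) (N + c - (r + 1 : ℕ)) hi a (rect N (r + 1) c f) (rect (N - 1) r c f') := by
  intro j hj1 hj2
  push_cast at hj1
  split_ifs with e
  · subst e
    rw [cap_rect_right a r c hr (by omega) (by omega), h N (by omega) (by omega), if_pos rfl]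
    intro q h5 h6
    rw [h q (by omega) (by omega), if_neg (by omega)]
  · rcases lt_or_gt_of_ne e with e | e
    · obtain ⟨s, rfl⟩ : ∃ s : ℕ, j = N + c - (s + 1) := ⟨(N + c - 1 - j).toNat, by omega⟩
      apply cap_rect_inner_right a c s (r + 1) N hr (by omega) (by push_cast; omega) (by omega)
      rw [h _ (by omega) (by omega), if_neg (by omega)]
    · rw [cap_rect_of_gt a _ _ _ _ _ e, h _ (by omega) (by omega), if_neg (by omega), rect_zero]

theorem Vac.rect_left (h : Vac N lo hi a f f') (hr : Rel lo' hi' f) (h1 : lo' ≤ lo)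
    (h2 : hi ≤ hi') (r c : ℕ) (h3 : lo + r < N) (h4 : N + c < hi) :
    Vac (N - r) lo (N + (c + 1 : ℕ) - r) a (rect N r (c + 1) f) (rect (N - 1) r c f') := by
  intro j hj1 hj2
  push_cast at hj2
  split_ifs with e
  · subst e
    rw [cap_rect_left a c r N hr (by omega) (by omega), h N (by omega) (by omega), if_pos rfl]
    intro q h5 h6
    rw [h q (by omega) (by omega), if_neg (by omega)]
  · rcases lt_or_gt_of_ne e with e | e
    · rw [cap_rect_of_lt a _ _ _ _ _ e, h _ (by omega) (by omega), if_neg (by omega), rect_zero]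
    · obtain ⟨s, rfl⟩ : ∃ s : ℕ, j = N - r + (s + 1) := ⟨(j - N + r - 1).toNat, by omega⟩
      apply cap_rect_inner_left a (c + 1) s (by omega) r N hr (by omega) (by push_cast; omega)
      rw [h _ (by omega) (by omega), if_neg (by omega)]

end Rect

/-! ### Partitions as trees of valleys; deletion of peaks -/

/-- Partitions encoded by a lowest valley of their boundary: the rectangle with `r` rows and `c`
columns ending in the corresponding corner, the part `L` below it and the part `R` to its right. -/
inductive ValleyTree : Type
  | leaf : ValleyTree
  | node (r c : ℕ) (L R : ValleyTree) : ValleyTree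

namespace ValleyTree

/-- The operators of the boxes of a partition whose first box has content `N`. -/
def op : ValleyTree → ℤ → WordFun → WordFun
  | leaf, _, f => f
  | node r c L R, N, f => L.op (N - r) (R.op (N + c) (rect N r c f))

/-- The depth of the lowest valley. -/
def depth : ValleyTree → ℕ
  | leaf => 0
  | node r c _ _ => r + c - 1

theorem depth_leaf : leaf.depth = 0 := rfl

theorem depth_node (r c : ℕ) (L R : ValleyTree) : (node r c L R).depth = r + c - 1 := rfl

/-- The rectangle is not empty and its corner is a lowest valley. -/
def Valid : ValleyTree → Prop
  | leaf => True
  | node r c L R => 1 ≤ r ∧ 1 ≤ c ∧ L.depth + 1 ≤ c ∧ R.depth + 1 ≤ r ∧ L.Valid ∧ R.Valid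

/-- The positions of the increasing steps of the boundary path. -/
def Up : ValleyTree → ℤ → ℤ → Prop
  | leaf, N, q => q ≤ N
  | node r c L R, N, q => if q ≤ N + c - r then L.Up (N - r) q else R.Up (N + c) q

theorem eq_leaf {t : ValleyTree} (ht : t.Valid) (h : t.depth = 0) : t = leaf := by
  cases t with
  | leaf => rfl
  | node r c L R =>
    simp only [Valid, depth_node] at ht h
    omega

theorem up_of_le {t : ValleyTree} (ht : t.Valid) {N q : ℤ} (h : q ≤ N - t.depth) : t.Up N q := by
  induction t generalizing N q with
  | leaf => simpa [Up, depth_leaf] using h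
  | node r c L R ihL ihR =>
    obtain ⟨h1, h2, h3, h4, h5, h6⟩ := ht
    simp only [depth_node] at h
    rw [Up, if_pos (by omega)]
    exact ihL h5 (by omega)

theorem not_up_of_lt {t : ValleyTree} (ht : t.Valid) {N q : ℤ} (h : N + t.depth < q) :
    ¬ t.Up N q := by
  induction t generalizing N q with
  | leaf => simpa [Up, depth_leaf] using h
  | node r c L R ihL ihR =>
    obtain ⟨h1, h2, h3, h4, h5, h6⟩ := ht
    simp only [depth_node] at h
    rw [Up, if_neg (by omega)]
    exact ihR h6 (by omega)

theorem up_add (t : ValleyTree) (N q e : ℤ) : t.Up (N + e) (q + e) ↔ t.Up N q := by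
  induction t generalizing N with
  | leaf => simp [Up]
  | node r c L R ihL ihR =>
    simp only [Up]
    rw [show N + e - r = N - r + e by ring, show N + e + c = N + c + e by ring, ihL, ihR]
    by_cases h : q ≤ N + c - r
    · rw [if_pos h, if_pos (by omega)]
    · rw [if_neg h, if_neg (by omega)]

theorem op_intertwine {t : ValleyTree} (ht : t.Valid) (A : WordFun →ₗ[ℚ] WordFun) (e N : ℤ)
    (f : WordFun)
    (hA : ∀ j, N - t.depth < j → j < N + t.depth → ∀ k g, A (tOp j k g) = tOp (j + e) k (A g)) :
    A (t.op N f) = t.op (N + e) (A f) := by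
  induction t generalizing N f with
  | leaf => rfl
  | node r c L R ihL ihR =>
    obtain ⟨h1, h2, h3, h4, h5, h6⟩ := ht
    simp only [depth_node] at hA
    simp only [op]
    rw [ihL h5 _ _ fun j _ _ => hA j (by omega) (by omega),
      ihR h6 _ _ fun j _ _ => hA j (by omega) (by omega),
      rect_intertwine A e r c N f fun j _ _ => hA j (by omega) (by omega)]
    rw [show N - (r : ℤ) + e = N + e - r by ring, show N + (c : ℤ) + e = N + e + c by ring]

theorem op_zero (t : ValleyTree) (N : ℤ) : t.op N 0 = 0 := by
  induction t generalizing N with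
  | leaf => rfl
  | node r c L R ihL ihR => simp only [op, rect_zero, ihL, ihR]

theorem cap_op_of_gt {t : ValleyTree} (ht : t.Valid) (a : ℚ) {N p : ℤ} (f : WordFun)
    (hp : N + t.depth < p) : cap p a (t.op N f) = t.op N (cap p a f) := by
  rw [op_intertwine ht _ 0 N f fun j _ _ => cap_intertwine_of_lt a (by omega), add_zero]

theorem cap_op_of_lt {t : ValleyTree} (ht : t.Valid) (a : ℚ) {N p : ℤ} (f : WordFun)
    (hp : p < N - t.depth) : cap p a (t.op N f) = t.op (N - 2) (cap p a f) := by
  rw [op_intertwine ht _ (-2) N f fun j _ _ => cap_intertwine_of_gt a (by omega)]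
  rfl

/-- All positions of the operators of `s` stay at distance at least two from those of `t`. -/
theorem op_comm {s t : ValleyTree} (hs : s.Valid) (ht : t.Valid) {N K : ℤ} (f : WordFun)
    (h : N + s.depth < K - t.depth + 1) :
    s.op N (t.op K f) = t.op K (s.op N f) := by
  induction s generalizing N f with
  | leaf => rfl
  | node r c L R ihL ihR =>
    obtain ⟨h3, h4, h5, h6, h7, h8⟩ := hs
    simp only [depth_node] at h
    have tComm : ∀ j, j < N + (r + c - 1 : ℕ) → ∀ k g, t.op K (tOp j k g) = tOp j k (t.op K g) := by
      intro j hj k g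
      rw [op_intertwine ht (tOp j k) 0 K g fun i _ _ => tOp_intertwine_of_gt k (by omega), add_zero]
    have rowComm : ∀ (s : ℤ) (m k : ℕ) (g : WordFun), s + m ≤ N + (r + c - 1 : ℕ) →
        t.op K (rowOp s m k g) = rowOp s m k (t.op K g) := by
      intro s m
      induction m with
      | zero => intro k g _; rfl
      | succ m ih =>
        intro k g hm
        push_cast at hm
        rw [rowOp, tComm _ (by omega), ih _ _ (by omega), rowOp]
    have rectComm : ∀ (r' : ℕ) (s : ℤ) (g : WordFun), s + c ≤ N + (r + c - 1 : ℕ) →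
        t.op K (rect s r' c g) = rect s r' c (t.op K g) := by
      intro r'
      induction r' with
      | zero => intro s g _; rfl
      | succ r' ih =>
        intro s g hs
        rw [rect, ih _ _ (by omega), rowComm _ _ _ _ hs, rect]
    simp only [op]
    rw [← rectComm r N f (by omega), ihR h8 _ (by omega), ihL h7 _ (by omega)]

section Cap

variable {lo hi lo' hi' N p : ℤ} {a : ℚ} {f f' : WordFun}

/-- The depth bounds in `Valid` keep `L` and `R` away from the corner, so the cap passes both and is
killed by the rectangle. -/
theorem cap_op_corner {r c : ℕ} {L R : ValleyTree} (ht : (node r c L R).Valid) (a : ℚ) (N : ℤ)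
    (f : WordFun) : cap (N + c - r) a ((node r c L R).op N f) = 0 := by
  obtain ⟨h3, h4, h5, h6, h7, h8⟩ := ht
  obtain ⟨r, rfl⟩ : ∃ r', r = r' + 1 := ⟨r - 1, by omega⟩
  obtain ⟨c, rfl⟩ : ∃ c', c = c' + 1 := ⟨c - 1, by omega⟩
  have := cap_rect_corner a c r N f
  rw [op, cap_op_of_gt h7 a _ (by push_cast; omega), cap_op_of_lt h8 a _ (by push_cast; omega),
    show N + ((c + 1 : ℕ) : ℤ) - ((r + 1 : ℕ) : ℤ) = N + c - r by push_cast; ring, this,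
    op_zero, op_zero]

/-- The corner separates the positions. On either side the cap passes the part on the other side,
and the rectangle hands a function satisfying `Vac` to the part it must still cross. -/
theorem cap_op_of_not_peak {t : ValleyTree} (ht : t.Valid) (hv : Vac N lo hi a f f')
    (hr : Rel lo' hi' f) (h1 : lo' ≤ lo) (h2 : hi ≤ hi') (h3 : lo < N - t.depth)
    (h4 : N + t.depth < hi) (h5 : lo < p) (h6 : p < hi) (hp : ¬ (t.Up N p ∧ ¬ t.Up N (p + 1))) :
    cap p a (t.op N f) = 0 := by
  induction t generalizing N f f' lo hi with
  | leaf =>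
    simp only [op, Up] at hp ⊢
    rw [hv p h5 h6, if_neg (by omega)]
  | node r c L R ihL ihR =>
    have ht' := ht
    obtain ⟨g3, g4, g5, g6, g7, g8⟩ := ht
    simp only [depth_node] at h3 h4
    obtain ⟨r, rfl⟩ : ∃ r', r = r' + 1 := ⟨r - 1, by omega⟩
    obtain ⟨c, rfl⟩ : ∃ c', c = c' + 1 := ⟨c - 1, by omega⟩
    have hrr : Rel lo' hi' (rect N (r + 1) (c + 1) f) :=
      hr.rect _ _ N (by push_cast; omega) (by push_cast; omega)
    simp only [Up] at hp
    rcases lt_trichotomy p (N + (c + 1 : ℕ) - (r + 1 : ℕ)) with e | e | e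
    · rw [if_pos e.le, if_pos (by omega)] at hp
      rw [op, op_comm g7 g8 _ (by push_cast; omega), cap_op_of_lt g8 a _ (by push_cast at e ⊢; omega)]
      rw [ihL g7 (hv.rect_left hr h1 h2 (r + 1) c (by push_cast; omega) (by omega)) hrr h1
        (by push_cast; omega) (by push_cast; omega) (by push_cast; omega) h5 (by exact e) hp, op_zero]
    · rw [e, cap_op_corner ht']
    · rw [if_neg (by omega), if_neg (by omega)] at hp
      rw [op, cap_op_of_gt g7 a _ (by push_cast at e ⊢; omega)]
      rw [ihR g8 (hv.rect_right hr h1 h2 r (c + 1) (by omega) (by push_cast; omega)) hrr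
        (by push_cast; omega) h2 (by push_cast; omega) (by push_cast; omega) (by exact e) h6 hp,
        op_zero]

/-- Deletion of a peak of the boundary path. -/
theorem exists_cap_op_of_peak {t : ValleyTree} (ht : t.Valid) (hp : t.Up N p)
    (hp' : ¬ t.Up N (p + 1)) :
    ∃ t' : ValleyTree, t'.Valid ∧ t'.depth ≤ t.depth - 1 ∧
      (∀ q, t'.Up (N - 1) q ↔ if q < p then t.Up N q else t.Up N (q + 2)) ∧
      ∀ (lo hi lo' hi' : ℤ) (a : ℚ) (f f' : WordFun), Vac N lo hi a f f' → Rel lo' hi' f →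
        lo' ≤ lo → hi ≤ hi' → lo < N - t.depth → N + t.depth < hi →
        cap p a (t.op N f) = t'.op (N - 1) f' := by
  induction t generalizing N with
  | leaf =>
    simp only [Up] at hp hp'
    obtain rfl : p = N := by omega
    refine ⟨leaf, trivial, by simp [depth_leaf], fun q => ?_, ?_⟩
    · simp only [Up]
      split_ifs <;> omega
    · intro lo hi lo' hi' a f f' hv hr h1 h2 h3 h4
      simp only [depth_leaf] at h3 h4
      simp only [op]
      rw [hv p (by omega) (by omega), if_pos rfl]
  | node r c L R ihL ihR =>
    have ht' := ht
    obtain ⟨g3, g4, g5, g6, g7, g8⟩ := ht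
    obtain ⟨r, rfl⟩ : ∃ r', r = r' + 1 := ⟨r - 1, by omega⟩
    obtain ⟨c, rfl⟩ : ∃ c', c = c' + 1 := ⟨c - 1, by omega⟩
    simp only [Up] at hp hp'
    -- The corner is a valley, and its position is a decreasing step because `L` is shallower than
    -- the width of the rectangle.
    have hne : p ≠ N + (c + 1 : ℕ) - (r + 1 : ℕ) := by
      rintro rfl
      rw [if_pos le_rfl] at hp
      exact not_up_of_lt g7 (by push_cast; omega) hp
    rcases lt_or_gt_of_ne hne with e | e
    · rw [if_pos e.le] at hp
      rw [if_pos (by omega)] at hp'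
      obtain ⟨L', v1, v2, v3, v4⟩ := ihL g7 hp hp'
      have shift : ∀ q, R.Up (N + (c + 1 : ℕ) - 2) q ↔ R.Up (N + (c + 1 : ℕ)) (q + 2) := by
        intro q
        rw [← up_add R (N + (c + 1 : ℕ) - 2) q 2]
        simp
      have capEq : ∀ (lo hi lo' hi' : ℤ) (a : ℚ) (f f' : WordFun), Vac N lo hi a f f' →
          Rel lo' hi' f → lo' ≤ lo → hi ≤ hi' →
          lo < N - (node (r + 1) (c + 1) L R).depth → N + (node (r + 1) (c + 1) L R).depth < hi →
          cap p a ((node (r + 1) (c + 1) L R).op N f) =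
            R.op (N + (c + 1 : ℕ) - 2) (L'.op (N - (r + 1 : ℕ) - 1) (rect (N - 1) (r + 1) c f')) := by
        intro lo hi lo' hi' a f f' hv hr h1 h2 h3 h4
        simp only [depth_node] at h3 h4
        rw [op, op_comm g7 g8 _ (by push_cast; omega),
          cap_op_of_lt g8 a _ (by push_cast at e ⊢; omega)]
        rw [v4 _ _ _ _ a _ _ (hv.rect_left hr h1 h2 (r + 1) c (by push_cast; omega) (by omega))
          (hr.rect _ _ N (by push_cast; omega) (by push_cast; omega)) h1 (by push_cast; omega)
          (by push_cast; omega) (by push_cast; omega)]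
      -- A peak on the left removes a column. If it was the only one, the depth bound forces `L` to
      -- be a leaf, and only `R` survives.
      rcases Nat.eq_zero_or_pos c with rfl | hc
      · obtain rfl := eq_leaf g7 (by omega)
        obtain rfl := eq_leaf v1 (by simp only [depth_leaf] at v2 ⊢; omega)
        simp only [Up] at hp hp'
        refine ⟨R, g8, by simp only [depth_node]; omega, fun q => ?_, ?_⟩
        · have s := shift q
          rw [show N + ((0 + 1 : ℕ) : ℤ) - 2 = N - 1 by push_cast; ring] at s
          simp only [Up]
          push_cast at *
          split_ifs with a1 a2 a3
          · exact ⟨fun _ => by omega, fun _ => up_of_le g8 (by omega)⟩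
          · omega
          · omega
          · exact s
        · intro lo hi lo' hi' a f f' hv hr h1 h2 h3 h4
          rw [capEq lo hi lo' hi' a f f' hv hr h1 h2 h3 h4]
          have rectNil : ∀ (m : ℕ) (K : ℤ) (g : WordFun), rect K m 0 g = g := by
            intro m
            induction m with
            | zero => intro K g; rfl
            | succ m ih => intro K g; rw [rect, ih]; rfl
          rw [op, rectNil, show N + ((0 + 1 : ℕ) : ℤ) - 2 = N - 1 by push_cast; ring]
      · have hval : (node (r + 1) c L' R).Valid := ⟨by omega, hc, by omega, g6, v1, g8⟩
        refine ⟨node (r + 1) c L' R, hval, by simp only [depth_node]; omega, fun q => ?_, ?_⟩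
        · have s := shift q
          have v := v3 q
          simp only [Up]
          rw [show N - 1 + (c : ℤ) = N + (c + 1 : ℕ) - 2 by push_cast; ring,
            show N - 1 - ((r + 1 : ℕ) : ℤ) = N - (r + 1 : ℕ) - 1 by ring, s, v]
          push_cast at *
          split_ifs <;> first | rfl | omega
        · intro lo hi lo' hi' a f f' hv hr h1 h2 h3 h4
          rw [capEq lo hi lo' hi' a f f' hv hr h1 h2 h3 h4, op,
            show N - 1 - ((r + 1 : ℕ) : ℤ) = N - (r + 1 : ℕ) - 1 by ring,
            show N - 1 + (c : ℤ) = N + (c + 1 : ℕ) - 2 by push_cast; ring,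
            op_comm v1 g8 _ (by push_cast; omega)]
    · rw [if_neg (by omega)] at hp hp'
      obtain ⟨R', v1, v2, v3, v4⟩ := ihR g8 hp hp'
      have capEq : ∀ (lo hi lo' hi' : ℤ) (a : ℚ) (f f' : WordFun), Vac N lo hi a f f' →
          Rel lo' hi' f → lo' ≤ lo → hi ≤ hi' →
          lo < N - (node (r + 1) (c + 1) L R).depth → N + (node (r + 1) (c + 1) L R).depth < hi →
          cap p a ((node (r + 1) (c + 1) L R).op N f) =
            L.op (N - (r + 1 : ℕ)) (R'.op (N + (c + 1 : ℕ) - 1) (rect (N - 1) r (c + 1) f')) := by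
        intro lo hi lo' hi' a f f' hv hr h1 h2 h3 h4
        simp only [depth_node] at h3 h4
        rw [op, cap_op_of_gt g7 a _ (by push_cast at e ⊢; omega)]
        rw [v4 _ _ _ _ a _ _ (hv.rect_right hr h1 h2 r (c + 1) (by omega) (by push_cast; omega))
          (hr.rect _ _ N (by push_cast; omega) (by push_cast; omega)) (by push_cast; omega) h2
          (by push_cast; omega) (by push_cast; omega)]
      -- Symmetrically, a peak on the right removes a row; if it was the only one, only `L`
      -- survives.
      rcases Nat.eq_zero_or_pos r with rfl | hc
      · obtain rfl := eq_leaf g8 (by omega)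
        obtain rfl := eq_leaf v1 (by simp only [depth_leaf] at v2 ⊢; omega)
        simp only [Up] at hp hp'
        refine ⟨L, g7, by simp only [depth_node]; omega, fun q => ?_, ?_⟩
        · simp only [Up]
          rw [show N - ((0 + 1 : ℕ) : ℤ) = N - 1 by push_cast; ring]
          push_cast at *
          split_ifs with a1 a2 a3
          · rfl
          · exact absurd a2 (by omega)
          · exact absurd a3 (by omega)
          · exact ⟨fun h => absurd h (not_up_of_lt g7 (by omega)), fun h => by omega⟩
        · intro lo hi lo' hi' a f f' hv hr h1 h2 h3 h4
          rw [capEq lo hi lo' hi' a f f' hv hr h1 h2 h3 h4]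
          rw [op, rect, show N - ((0 + 1 : ℕ) : ℤ) = N - 1 by push_cast; ring]
      · have hval : (node r (c + 1) L R').Valid := ⟨by omega, by omega, g5, by omega, g7, v1⟩
        refine ⟨node r (c + 1) L R', hval, by simp only [depth_node]; omega, fun q => ?_, ?_⟩
        · have v := v3 q
          simp only [Up]
          rw [show N - 1 + ((c + 1 : ℕ) : ℤ) = N + (c + 1 : ℕ) - 1 by ring,
            show N - 1 - (r : ℤ) = N - (r + 1 : ℕ) by push_cast; ring, v]
          push_cast at *
          split_ifs <;> first | rfl | omega
        · intro lo hi lo' hi' a f f' hv hr h1 h2 h3 h4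
          rw [capEq lo hi lo' hi' a f f' hv hr h1 h2 h3 h4, op,
            show N - 1 + ((c + 1 : ℕ) : ℤ) = N + (c + 1 : ℕ) - 1 by ring,
            show N - 1 - (r : ℤ) = N - (r + 1 : ℕ) by push_cast; ring]

end Cap

end ValleyTree

/-! ### The starting function -/

/-- The Vandermonde product in the `n` letters of a word starting from position `s`. -/
def block (s : ℤ) (n : ℕ) (w : ℤ → ℚ) : ℚ :=
  ∏ i : Fin n, ∏ j ∈ Finset.Ioi i, (w (s + (i : ℕ)) - w (s + (j : ℕ)))

/-- The product of the Vandermonde products in the first `n` and in the next `n` letters. -/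
def twoBlocks (n : ℕ) : WordFun := fun w => block 1 n w * block (n + 1) n w

theorem block_eq_det (s : ℤ) (n : ℕ) (w : ℤ → ℚ) :
    block s n w = (Matrix.vandermonde fun i : Fin n => -w (s + (i : ℕ))).det := by
  rw [Matrix.det_vandermonde, block]
  refine Finset.prod_congr rfl fun i _ => Finset.prod_congr rfl fun j _ => ?_
  ring

theorem block_swap {s p q : ℤ} {n : ℕ} (w : ℤ → ℚ) (hp : p ∈ Set.Ico s (s + n))
    (hq : q ∈ Set.Ico s (s + n)) (hpq : p ≠ q) :
    block s n (w ∘ Equiv.swap p q) = -block s n w := by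
  obtain ⟨i, rfl⟩ : ∃ i : Fin n, p = s + (i : ℕ) :=
    ⟨⟨(p - s).toNat, by have := hp.1; have := hp.2; omega⟩, by have := hp.1; simp; omega⟩
  obtain ⟨j, rfl⟩ : ∃ j : Fin n, q = s + (j : ℕ) :=
    ⟨⟨(q - s).toNat, by have := hq.1; have := hq.2; omega⟩, by have := hq.1; simp; omega⟩
  have hij : i ≠ j := by rintro rfl; exact hpq rfl
  rw [block_eq_det, block_eq_det]
  have := Matrix.det_permute (Equiv.swap i j)
    (Matrix.vandermonde fun i : Fin n => -w (s + (i : ℕ)))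
  rw [Equiv.Perm.sign_swap hij] at this
  have h2 : (Matrix.vandermonde fun i : Fin n => -w (s + (i : ℕ))).submatrix (Equiv.swap i j) id =
      Matrix.vandermonde fun k : Fin n =>
        -(w ∘ Equiv.swap (s + ((i : ℕ) : ℤ)) (s + ((j : ℕ) : ℤ))) (s + (k : ℕ)) := by
    ext k l
    simp only [Matrix.submatrix_apply, Matrix.vandermonde_apply, Function.comp_apply, id]
    congr 3
    simp only [Equiv.swap_apply_def, Fin.ext_iff]
    split_ifs <;> first | rfl | omega
  rw [h2] at this
  rw [this]
  simp

theorem block_congr {s : ℤ} {n : ℕ} {w w' : ℤ → ℚ} {e : ℤ}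
    (h : ∀ p, s ≤ p → p < s + n → w p = w' (p + e)) : block s n w = block (s + e) n w' := by
  refine Finset.prod_congr rfl fun i _ => Finset.prod_congr rfl fun j _ => ?_
  rw [h _ (by omega) (by omega), h _ (by omega) (by omega)]
  congr 2 <;> ring

theorem block_succ (s : ℤ) (n : ℕ) (w : ℤ → ℚ) :
    block s (n + 1) w = (∏ j ∈ Finset.range n, (w s - w (s + 1 + j))) * block (s + 1) n w := by
  rw [block, Fin.prod_univ_succ, Fin.prod_Ioi_zero, Finset.prod_range]
  congr 1
  · refine Finset.prod_congr rfl fun i _ => ?_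
    simp only [Fin.val_succ, Fin.val_zero]
    push_cast
    rw [add_zero, add_assoc s 1, add_comm (1 : ℤ)]
  · refine Finset.prod_congr rfl fun i _ => ?_
    rw [Fin.prod_Ioi_succ]
    refine Finset.prod_congr rfl fun j _ => ?_
    simp only [Fin.val_succ]
    push_cast
    congr 2 <;> ring

theorem block_succ' (n : ℕ) : ∀ (s : ℤ) (w : ℤ → ℚ),
    block s (n + 1) w = block s n w * ∏ j ∈ Finset.range n, (w (s + j) - w (s + n)) := by
  induction n with
  | zero => intro s w; simp [block]
  | succ n ih =>
    intro s w
    rw [block_succ, ih, block_succ s n, Finset.prod_range_succ, Finset.prod_range_succ' _ n]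
    push_cast
    simp only [add_zero, add_assoc, add_comm (1 : ℤ)]
    ring

theorem twoBlocks_swap {n : ℕ} {p q : ℤ} (w : ℤ → ℚ) (hp : p ∈ Set.Ioc 0 (2 * n : ℤ))
    (hq : q ∈ Set.Ioc 0 (2 * n : ℤ)) (hpq : p ≠ q) (h : p ≤ n ↔ q ≤ n) :
    twoBlocks n (w ∘ Equiv.swap p q) = -twoBlocks n w := by
  obtain ⟨hp1, hp2⟩ := hp
  obtain ⟨hq1, hq2⟩ := hq
  rw [twoBlocks, twoBlocks]
  by_cases hpn : p ≤ n
  · rw [block_swap w ⟨by omega, by omega⟩ ⟨by omega, by omega⟩ hpq,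
      block_congr (s := n + 1) (e := 0) (w' := w), add_zero, neg_mul]
    intro x h1 h2
    rw [Function.comp_apply, Equiv.swap_apply_of_ne_of_ne (by omega) (by omega), add_zero]
  · rw [block_swap (s := n + 1) w ⟨by omega, by omega⟩ ⟨by omega, by omega⟩ hpq,
      block_congr (s := 1) (e := 0) (w' := w), add_zero, mul_neg]
    intro x h1 h2
    rw [Function.comp_apply, Equiv.swap_apply_of_ne_of_ne (by omega) (by omega), add_zero]

theorem twoBlocks_eq_zero {n : ℕ} {p q : ℤ} {w : ℤ → ℚ} (hp : p ∈ Set.Ioc 0 (2 * n : ℤ))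
    (hq : q ∈ Set.Ioc 0 (2 * n : ℤ)) (hpq : p ≠ q) (h : p ≤ n ↔ q ≤ n) (hw : w p = w q) :
    twoBlocks n w = 0 := by
  have h1 := twoBlocks_swap w hp hq hpq h
  have h2 : w ∘ Equiv.swap p q = w := by
    funext x
    rw [Function.comp_apply, Equiv.swap_apply_def]
    split_ifs with h3 h4
    · rw [h3, hw]
    · rw [h4, hw]
    · rfl
  rw [h2] at h1
  linarith

/-- Two of the three positions lie in the same block. By antisymmetry there, one term vanishes on
equal letters and the other two are opposite. -/
theorem rel_twoBlocks (n : ℕ) : Rel 0 (2 * n) (twoBlocks n) := by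
  intro w p q r hp hq hr hpq hpr hqr hw
  by_cases h : p ≤ n ↔ q ≤ n
  · have e : w ∘ Equiv.swap p r = (w ∘ Equiv.swap q r) ∘ Equiv.swap p q := by
      funext x
      simp only [Function.comp_apply]
      rcases eq_or_ne x p with rfl | h1
      · rw [Equiv.swap_apply_left, Equiv.swap_apply_left, Equiv.swap_apply_left]
      rcases eq_or_ne x q with rfl | h2
      · rw [Equiv.swap_apply_right, Equiv.swap_apply_of_ne_of_ne hpq.symm hqr,
          Equiv.swap_apply_of_ne_of_ne hpq hpr, hw]
      rw [Equiv.swap_apply_of_ne_of_ne h1 h2]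
      rcases eq_or_ne x r with rfl | h3
      · rw [Equiv.swap_apply_right, Equiv.swap_apply_right, hw]
      rw [Equiv.swap_apply_of_ne_of_ne h1 h3, Equiv.swap_apply_of_ne_of_ne h2 h3]
    rw [e, twoBlocks_swap _ hp hq hpq h, twoBlocks_eq_zero hp hq hpq h hw]
    ring
  · by_cases h' : p ≤ n ↔ r ≤ n
    · rw [twoBlocks_swap _ hp hr hpr h', twoBlocks_eq_zero (w := w ∘ Equiv.swap q r) hp hr hpr h']
      · ring
      · rw [Function.comp_apply, Function.comp_apply, Equiv.swap_apply_right,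
          Equiv.swap_apply_of_ne_of_ne hpq hpr, hw]
    · have h'' : q ≤ n ↔ r ≤ n := by tauto
      rw [twoBlocks_swap _ hq hr hqr h'', twoBlocks_eq_zero (w := w ∘ Equiv.swap p r) hq hr hqr h'']
      · ring
      · rw [Function.comp_apply, Function.comp_apply, Equiv.swap_apply_right,
          Equiv.swap_apply_of_ne_of_ne hpq.symm hqr, hw]

/-- Multiplication by the product of the values `w_p - a` over the first `m` letters. -/
def mulDiff (m : ℕ) (a : ℚ) : WordFun →ₗ[ℚ] WordFun where
  toFun f w := (∏ p ∈ Finset.range m, (w (1 + p) - a)) * f w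
  map_add' f g := by funext w; simp only [Pi.add_apply]; ring
  map_smul' c f := by funext w; simp only [Pi.smul_apply, smul_eq_mul, RingHom.id_apply]; ring

theorem mulDiff_apply (m : ℕ) (a : ℚ) (f : WordFun) (w : ℤ → ℚ) :
    mulDiff m a f w = (∏ p ∈ Finset.range m, (w (1 + p) - a)) * f w := rfl

theorem mulDiff_tOp {m : ℕ} (a : ℚ) {i : ℤ} (h1 : 0 < i) (h2 : i < m) (k : ℕ) (f : WordFun) :
    mulDiff m a (tOp i k f) = tOp i k (mulDiff m a f) := by
  funext w
  have e : ∏ p ∈ Finset.range m, ((w ∘ Equiv.swap i (i + 1)) (1 + p) - a) =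
      ∏ p ∈ Finset.range m, (w (1 + p) - a) := by
    obtain ⟨j, rfl⟩ : ∃ j : ℕ, i = 1 + j := ⟨(i - 1).toNat, by omega⟩
    refine Finset.prod_equiv (Equiv.swap j (j + 1)) (fun p => ?_) fun p _ => ?_
    · rw [Equiv.swap_apply_def]
      simp only [Finset.mem_range]
      split_ifs <;> omega
    · rw [Function.comp_apply]
      congr 2
      simp only [Equiv.swap_apply_def]
      split_ifs <;> push_cast <;> omega
  simp only [mulDiff_apply, tOp_apply, e]
  ring

/-- Adjacent equal letters kill the product unless they straddle the two blocks. In that case the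
factors involving `a` form a symmetric product over all the other letters, with a sign for the
second block. -/
theorem vac_twoBlocks (n : ℕ) (a : ℚ) :
    Vac (n + 1 : ℕ) 0 (2 * (n + 1 : ℕ)) a (twoBlocks (n + 1))
      ((-1 : ℚ) ^ n • mulDiff (2 * n) a (twoBlocks n)) := by
  intro j hj1 hj2
  split_ifs with h
  · subst h
    funext w
    have b1 : block 1 (n + 1) (ins (n + 1 : ℕ) a w) =
        block 1 n w * ∏ p ∈ Finset.range n, (w (1 + p) - a) := by
      rw [block_succ']
      congr 1
      · rw [block_congr (e := 0) (w' := w), add_zero]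
        intro p h1 h2
        rw [ins, if_pos (by push_cast; omega), add_zero]
      · refine Finset.prod_congr rfl fun p hp => ?_
        rw [Finset.mem_range] at hp
        rw [ins, if_pos (by push_cast; omega), ins, if_neg (by push_cast; omega),
          if_pos (by push_cast; omega)]
    have b2 : block ((n + 1 : ℕ) + 1) (n + 1) (ins (n + 1 : ℕ) a w) =
        (∏ p ∈ Finset.range n, (a - w (1 + (n + p : ℕ)))) * block (n + 1) n w := by
      rw [block_succ]
      congr 1
      · refine Finset.prod_congr rfl fun p hp => ?_
        rw [ins, if_neg (by push_cast; omega), if_pos (by push_cast; omega), ins,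
          if_neg (by push_cast; omega), if_neg (by push_cast; omega)]
        congr 2
        push_cast
        ring
      · rw [block_congr (e := -2) (w' := w)]
        · congr 1
          push_cast
          ring
        intro p h1 h2
        rw [ins, if_neg (by push_cast at *; omega), if_neg (by push_cast at *; omega)]
        rfl
    have b3 : ∏ p ∈ Finset.range n, (a - w (1 + (n + p : ℕ))) =
        (-1) ^ n * ∏ p ∈ Finset.range n, (w (1 + (n + p : ℕ)) - a) := by
      rw [← Finset.card_range n, ← Finset.prod_const, Finset.card_range, ← Finset.prod_mul_distrib]
      refine Finset.prod_congr rfl fun p _ => ?_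
      ring
    rw [cap_apply, twoBlocks, b1, b2, b3, Pi.smul_apply, mulDiff_apply, two_mul,
      Finset.prod_range_add, twoBlocks, smul_eq_mul]
    ring
  · funext w
    rw [cap_apply, Pi.zero_apply]
    apply twoBlocks_eq_zero (p := j) (q := j + 1) ⟨by omega, by omega⟩ ⟨by omega, by omega⟩
      (by omega) (by omega)
    rw [ins, if_neg (by omega), if_pos (by omega), ins, if_neg (by omega), if_pos (by omega)]

/-! ### Words and labels of paths -/

/-- The letters of a list, in positions `1, 2, …`. -/
def wordOf (v : List ℕ) : ℤ → ℚ :=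
  fun z => if z ≤ 0 then 0 else ((v.getD (z.toNat - 1) 0 : ℕ) : ℚ)

theorem wordOf_insert (x y : List ℕ) (a : ℕ) :
    wordOf (x ++ a :: a :: y) = ins (x.length + 1) a (wordOf (x ++ y)) := by
  funext z
  rcases le_or_gt z 0 with h | h
  · rw [wordOf, if_pos h, ins, if_pos (by omega), wordOf, if_pos h]
  rw [wordOf, if_neg (by omega), ins]
  obtain ⟨m, rfl⟩ : ∃ m : ℕ, z = m + 1 := ⟨(z - 1).toNat, by omega⟩
  have e : ((m : ℤ) + 1).toNat - 1 = m := by omega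
  rw [e]
  split_ifs with h1 h2
  · rw [wordOf, if_neg (by omega), e, List.getD_append _ _ _ _ (by omega),
      List.getD_append _ _ _ _ (by omega)]
  · rw [List.getD_append_right _ _ _ _ (by omega)]
    obtain h3 | h3 : m - x.length = 0 ∨ m - x.length = 1 := by omega
    · rw [h3]; rfl
    · rw [h3]; rfl
  · obtain ⟨l, rfl⟩ : ∃ l, m = x.length + (l + 2) := ⟨m - x.length - 2, by omega⟩
    rw [wordOf, if_neg (by omega), List.getD_append_right _ _ _ _ (by omega),
      List.getD_append_right _ _ _ _ (by omega),
      show (((x.length + (l + 2) : ℕ) : ℤ) + 1 - 2).toNat - 1 - x.length = l by omega,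
      show x.length + (l + 2) - x.length = l + 2 by omega]
    rfl

theorem prod_wordOf (v : List ℕ) (φ : ℚ → ℚ) :
    ∏ p ∈ Finset.range v.length, φ (wordOf v (1 + p)) = (v.map fun b : ℕ => φ b).prod := by
  rw [Finset.prod_range, ← List.prod_ofFn]
  congr 1
  apply List.ext_getElem
  · simp
  · intro i h1 h2
    rw [List.length_ofFn] at h1
    simp only [List.getElem_ofFn, List.getElem_map, wordOf]
    rw [if_neg (by omega), show (1 + (i : ℤ)).toNat - 1 = i by omega, List.getD_eq_getElem _ _ h1]

/-- The labelling of the steps of a path with the labels of the increasing steps taken from a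
list `F`; the list `st` holds the labels of the steps not yet paired. -/
def labelFrom : List DyckStep → List ℕ → List ℕ → List ℕ
  | [], _, _ => []
  | DyckStep.U :: w, [], st => 0 :: labelFrom w [] (0 :: st)
  | DyckStep.U :: w, a :: F, st => a :: labelFrom w F (a :: st)
  | DyckStep.D :: w, F, [] => 0 :: labelFrom w F []
  | DyckStep.D :: w, F, a :: st => a :: labelFrom w F st

theorem labelSteps_eq_labelFrom (w : List DyckStep) :
    ∀ (k m : ℕ) (st : List ℕ), w.count DyckStep.U ≤ m →
      labelSteps w k st = labelFrom w ((List.range' k m).map (2 * ·)) st := by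
  induction w with
  | nil => intro k m st _; rfl
  | cons s w ih =>
    intro k m st h
    cases s with
    | U =>
      rw [List.count_cons_self] at h
      obtain ⟨m, rfl⟩ : ∃ m', m = m' + 1 := ⟨m - 1, by omega⟩
      rw [labelSteps, ih (k + 1) m _ (by omega), List.range'_succ, List.map_cons, labelFrom]
    | D =>
      rw [List.count_cons_of_ne (by decide)] at h
      cases st with
      | nil => rw [labelSteps, ih k m _ h, labelFrom]
      | cons a st => rw [labelSteps, ih k m _ h, labelFrom]

/-- A decreasing step right after an increasing one takes its label and restores the stack, so
removing both, and that label from the supply, changes no other label. -/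
theorem labelFrom_insert (u v : List DyckStep) :
    ∀ (F st : List ℕ), u.count DyckStep.U < F.length →
      ∃ (a : ℕ) (F₁ F₂ x y : List ℕ), F = F₁ ++ a :: F₂ ∧
        labelFrom (u ++ DyckStep.U :: DyckStep.D :: v) F st = x ++ a :: a :: y ∧
        labelFrom (u ++ v) (F₁ ++ F₂) st = x ++ y ∧ x.length = u.length := by
  induction u with
  | nil =>
    intro F st h
    obtain ⟨a, F, rfl⟩ := List.exists_cons_of_length_pos (by omega : 0 < F.length)
    exact ⟨a, [], F, [], labelFrom v F st, rfl, rfl, rfl, rfl⟩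
  | cons s u ih =>
    intro F st h
    cases s with
    | U =>
      rw [List.count_cons_self] at h
      obtain ⟨b, F, rfl⟩ := List.exists_cons_of_length_pos (by omega : 0 < F.length)
      obtain ⟨a, F₁, F₂, x, y, rfl, h2, h3, h4⟩ := ih F (b :: st) (by simpa using h)
      refine ⟨a, b :: F₁, F₂, b :: x, y, rfl, ?_, ?_, by simp [h4]⟩
      · rw [List.cons_append, labelFrom, h2, List.cons_append]
      · rw [List.cons_append, List.cons_append, labelFrom, h3, List.cons_append]
    | D =>
      rw [List.count_cons_of_ne (by decide)] at h
      cases st with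
      | nil =>
        obtain ⟨a, F₁, F₂, x, y, h1, h2, h3, h4⟩ := ih F [] h
        refine ⟨a, F₁, F₂, 0 :: x, y, h1, ?_, ?_, by simp [h4]⟩
        · rw [List.cons_append, labelFrom, h2, List.cons_append]
        · rw [List.cons_append, labelFrom, h3, List.cons_append]
      | cons b st =>
        obtain ⟨a, F₁, F₂, x, y, h1, h2, h3, h4⟩ := ih F st h
        refine ⟨a, F₁, F₂, b :: x, y, h1, ?_, ?_, by simp [h4]⟩
        · rw [List.cons_append, labelFrom, h2, List.cons_append]
        · rw [List.cons_append, labelFrom, h3, List.cons_append]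

open Classical in
/-- The path whose increasing steps are those in the positions `1, …, 2n` that satisfy `M`. -/
noncomputable def pathList (M : ℤ → Prop) (n : ℕ) : List DyckStep :=
  (List.range (2 * n)).map fun k : ℕ => if M ((k : ℤ) + 1) then DyckStep.U else DyckStep.D

theorem pathList_of_peak {M M' : ℤ → Prop} {n : ℕ} {p : ℤ} (h1 : 1 ≤ p) (h2 : p ≤ 2 * n + 1)
    (hp : M p) (hp' : ¬ M (p + 1)) (hM : ∀ q, M' q ↔ if q < p then M q else M (q + 2)) :
    ∃ u v : List DyckStep, pathList M (n + 1) = u ++ DyckStep.U :: DyckStep.D :: v ∧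
      pathList M' n = u ++ v ∧ (u.length : ℤ) + 1 = p := by
  classical
  obtain ⟨m, rfl⟩ : ∃ m : ℕ, p = m + 1 := ⟨(p - 1).toNat, by omega⟩
  obtain ⟨l, hl⟩ : ∃ l, 2 * n = m + l := ⟨2 * n - m, by omega⟩
  set F : ℕ → DyckStep := fun k => if M ((k : ℤ) + 1) then DyckStep.U else DyckStep.D with hF
  refine ⟨(List.range m).map F, (List.range l).map fun k => F (m + 2 + k), ?_, ?_, by simp⟩
  · rw [pathList, show 2 * (n + 1) = m + 2 + l by omega, List.range_add, List.map_append,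
      List.range_succ, List.range_succ]
    simp only [List.map_append, List.map_cons, List.map_nil, List.map_map, List.append_assoc,
      List.cons_append, List.nil_append]
    rw [if_pos hp, if_neg (by push_cast; exact hp')]
    rfl
  · rw [pathList, hl, List.range_add, List.map_append, List.map_map]
    congr 1
    · refine List.map_congr_left fun k hk => ?_
      rw [List.mem_range] at hk
      exact if_congr ((hM _).trans (by rw [if_pos (by omega)])) rfl rfl
    · refine List.map_congr_left fun k hk => ?_
      refine if_congr ((hM _).trans ?_) rfl rfl
      rw [if_neg (by push_cast; omega)]
      have e : ((m + k : ℕ) : ℤ) + 1 + 2 = ((m + 2 + k : ℕ) : ℤ) + 1 := by push_cast; ring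
      rw [e]

/-! ### Evaluation by induction on the number of labels -/

/-- The product of the differences of all ordered pairs of distinct elements. -/
def diffProd (F : Finset ℕ) : ℚ :=
  ∏ a ∈ F, ∏ b ∈ F, if a = b then 1 else ((b : ℚ) - a)

theorem diffProd_insert {F : Finset ℕ} {a : ℕ} (ha : a ∉ F) :
    diffProd (insert a F) = (-1) ^ F.card * (∏ b ∈ F, ((b : ℚ) - a)) ^ 2 * diffProd F := by
  have e1 : ∏ b ∈ F, (if a = b then (1 : ℚ) else ((b : ℚ) - a)) = ∏ b ∈ F, ((b : ℚ) - a) := by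
    refine Finset.prod_congr rfl fun b hb => if_neg ?_
    rintro rfl
    exact ha hb
  have e2 : ∏ b ∈ F, (if b = a then (1 : ℚ) else ((a : ℚ) - b)) =
      (-1) ^ F.card * ∏ b ∈ F, ((b : ℚ) - a) := by
    rw [← Finset.prod_const, ← Finset.prod_mul_distrib]
    refine Finset.prod_congr rfl fun b hb => ?_
    rw [if_neg]
    · ring
    rintro rfl
    exact ha hb
  rw [diffProd, Finset.prod_insert ha, Finset.prod_insert ha, if_pos rfl, e1]
  have e3 : ∀ b ∈ F, ∏ x ∈ insert a F, (if b = x then (1 : ℚ) else ((x : ℚ) - b)) =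
      (if b = a then (1 : ℚ) else ((a : ℚ) - b)) *
        ∏ x ∈ F, (if b = x then (1 : ℚ) else ((x : ℚ) - b)) :=
    fun b _ => Finset.prod_insert ha
  rw [Finset.prod_congr rfl e3, Finset.prod_mul_distrib, e2, diffProd]
  ring

/-- The path is increasing at `N - t.depth` and decreasing at `N + t.depth + 1`, so it turns in
between. -/
theorem ValleyTree.exists_peak {t : ValleyTree} (ht : t.Valid) (N : ℤ) :
    ∃ p, N - t.depth ≤ p ∧ p ≤ N + t.depth ∧ t.Up N p ∧ ¬ t.Up N (p + 1) := by
  by_contra! h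
  have key : ∀ m : ℕ, (m : ℤ) ≤ 2 * t.depth + 1 → t.Up N (N - t.depth + m) := by
    intro m
    induction m with
    | zero => intro _; exact t.up_of_le ht (by simp)
    | succ m ih =>
      intro hm
      push_cast at hm
      have := h _ (by omega) (by omega) (ih (by omega))
      push_cast
      rwa [← add_assoc]
  exact ValleyTree.not_up_of_lt ht (by push_cast; omega) (key (2 * t.depth + 1) (by push_cast; rfl))

open Classical in
/-- The values of the functions attached to partitions at the words attached to partitions. -/
theorem ValleyTree.value (n : ℕ) :
    ∀ (s t : ValleyTree), s.Valid → t.Valid → s.depth ≤ n - 1 → t.depth ≤ n - 1 →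
      (pathList (t.Up n) n).count DyckStep.U = n ∧
      ∀ F : List ℕ, F.Nodup → F.length = n →
        (labelFrom (pathList (t.Up n) n) F []).length = 2 * n ∧
        (∀ φ : ℕ → ℚ, ((labelFrom (pathList (t.Up n) n) F []).map φ).prod =
          (∏ b ∈ F.toFinset, φ b) ^ 2) ∧
        s.op n (twoBlocks n) (wordOf (labelFrom (pathList (t.Up n) n) F [])) =
          diffProd F.toFinset * if s.Up n = t.Up n then 1 else 0 := by
  induction n with
  | zero =>
    intro s t hs ht hs' ht'
    obtain rfl := eq_leaf hs (by omega)
    obtain rfl := eq_leaf ht (by omega)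
    refine ⟨rfl, fun F _ hF => ?_⟩
    obtain rfl := List.length_eq_zero_iff.1 hF
    refine ⟨rfl, fun φ => ?_, ?_⟩
    · simp [pathList, labelFrom]
    · simp [op, twoBlocks, block, diffProd]
  | succ n ih =>
    intro s t hs ht hs' ht'
    obtain ⟨p, p1, p2, p3, p4⟩ := exists_peak ht (n + 1 : ℕ)
    obtain ⟨t', t1, t2, t3, -⟩ := exists_cap_op_of_peak ht p3 p4
    rw [show ((n + 1 : ℕ) : ℤ) - 1 = n by push_cast; ring] at t3
    obtain ⟨u, v, u1, u2, u3⟩ := pathList_of_peak (n := n) (p := p) (by push_cast at p1; omega)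
      (by push_cast at p2; omega) p3 p4 t3
    have hcount := (ih t' t' t1 t1 (by omega) (by omega)).1
    rw [u2, List.count_append] at hcount
    refine ⟨?_, fun F hF hFn => ?_⟩
    · rw [u1, List.count_append, List.count_cons_self, List.count_cons_of_ne (by decide)]
      omega
    obtain ⟨a, F₁, F₂, x, y, f1, f2, f3, f4⟩ := labelFrom_insert u v F [] (by omega)
    have hperm : F.Perm (a :: (F₁ ++ F₂)) := by rw [f1]; exact List.perm_middle
    have hnd := (hperm.nodup_iff.1 hF)
    rw [List.nodup_cons] at hnd
    have hlen : (F₁ ++ F₂).length = n := by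
      have := hperm.length_eq
      rw [List.length_cons] at this
      omega
    have hfin : F.toFinset = insert a (F₁ ++ F₂).toFinset := by
      rw [← List.toFinset_cons, List.toFinset_eq_of_perm _ _ hperm]
    have ha : a ∉ (F₁ ++ F₂).toFinset := by rw [List.mem_toFinset]; exact hnd.1
    have key := fun s' (h1 : s'.Valid) h2 => (ih s' t' h1 t1 h2 (by omega)).2 _ hnd.2 hlen
    obtain ⟨k1, k2, -⟩ := key t' t1 (by omega)
    rw [u2, f3] at k1 k2
    rw [u1, f2]
    refine ⟨?_, fun φ => ?_, ?_⟩
    · simp only [List.length_append, List.length_cons] at k1 ⊢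
      omega
    · rw [hfin, Finset.prod_insert ha, mul_pow, ← k2 φ]
      simp only [List.map_append, List.map_cons, List.prod_append, List.prod_cons]
      ring
    · rw [wordOf_insert, f4, u3, ← cap_apply p a (s.op (n + 1 : ℕ) (twoBlocks (n + 1)))]
      -- The peak `p` was chosen on the path of `t`; if `s` has no peak there, the paths differ and
      -- both sides are zero.
      by_cases hsp : s.Up (n + 1 : ℕ) p ∧ ¬ s.Up (n + 1 : ℕ) (p + 1)
      · obtain ⟨s', s1, s2, s3, s4⟩ := exists_cap_op_of_peak hs hsp.1 hsp.2
        rw [s4 0 (2 * (n + 1 : ℕ)) 0 (2 * (n + 1 : ℕ)) a _ _ (vac_twoBlocks n a)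
          (rel_twoBlocks (n + 1)) le_rfl le_rfl (by push_cast; omega) (by push_cast; omega),
          show ((n + 1 : ℕ) : ℤ) - 1 = n by push_cast; ring]
        rw [show ((n + 1 : ℕ) : ℤ) - 1 = n by push_cast; ring] at s3
        obtain ⟨-, -, k3⟩ := key s' s1 (by omega)
        rw [u2, f3] at k3
        -- The factor is symmetric in the first `2 * n` letters, and the operators of `s'` permute
        -- only these.
        have hmul := op_intertwine s1 ((-1 : ℚ) ^ n • mulDiff (2 * n) a) 0 n (twoBlocks n) (by
          intro j h1 h2 k g
          rw [LinearMap.smul_apply, LinearMap.smul_apply, add_zero,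
            mulDiff_tOp _ (by omega) (by push_cast; omega), map_smul])
        rw [add_zero, LinearMap.smul_apply, LinearMap.smul_apply] at hmul
        rw [← hmul, Pi.smul_apply, mulDiff_apply, k3, ← k1,
          prod_wordOf (x ++ y) (fun b => b - a), k2, hfin, diffProd_insert ha,
          List.toFinset_card_of_nodup hnd.2, hlen]
        -- Both trees lose a peak in the same position, so nothing that distinguishes them is lost.
        have hiff : s'.Up n = t'.Up n ↔ s.Up (n + 1 : ℕ) = t.Up (n + 1 : ℕ) := by
          constructor
          · intro h
            funext q
            have h3 := fun q => congrFun h q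
            rcases lt_or_ge q p with h4 | h4
            · have := h3 q
              rw [propext (s3 q), propext (t3 q), if_pos h4, if_pos h4] at this
              exact this
            rcases eq_or_ne q p with rfl | h5
            · exact propext ⟨fun _ => p3, fun _ => hsp.1⟩
            rcases eq_or_ne q (p + 1) with rfl | h6
            · exact propext ⟨fun h => absurd h hsp.2, fun h => absurd h p4⟩
            have := h3 (q - 2)
            rw [propext (s3 _), propext (t3 _), if_neg (by omega), if_neg (by omega),
              sub_add_cancel] at this
            exact this
          · intro h
            funext q
            rw [propext (s3 q), propext (t3 q), h]
        rw [if_congr hiff rfl rfl, smul_eq_mul]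
        ring
      · rw [cap_op_of_not_peak hs (vac_twoBlocks n a) (rel_twoBlocks (n + 1)) le_rfl le_rfl
          (by push_cast; omega) (by push_cast; omega) (by push_cast at *; omega)
          (by push_cast at *; omega) hsp, if_neg, mul_zero, Pi.zero_apply]
        intro h
        rw [h] at hsp
        exact hsp ⟨p3, p4⟩

/-! ### From diagrams and levels to trees -/

/-- `k` is the largest distance from the box `(r, c)` to a box of the diagram with row lengths `ρ`
lying weakly below and to the right of it. -/
def IsLevel (ρ : ℕ → ℕ) (r c k : ℕ) : Prop :=
  (∃ a, r ≤ a ∧ c < ρ a ∧ a + ρ a = r + c + 1 + k) ∧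
    ∀ a, r ≤ a → c < ρ a → a + ρ a ≤ r + c + 1 + k

open Classical in
theorem mem_eraseCorners (lam : YoungDiagram) (x : ℕ × ℕ) :
    x ∈ eraseCorners lam ↔ x ∈ lam ∧ ¬ IsCorner lam x := by
  rw [← YoungDiagram.mem_cells, eraseCorners, Finset.mem_filter, YoungDiagram.mem_cells]

/-- A box survives one more erasure exactly when a neighbour below or to the right is still present,
which lowers the required distance by one. -/
theorem mem_eraseCorners_iterate (lam : YoungDiagram) (k : ℕ) :
    ∀ r c : ℕ, (r, c) ∈ eraseCorners^[k] lam ↔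
      ∃ a b, r ≤ a ∧ c ≤ b ∧ (a, b) ∈ lam ∧ r + c + k ≤ a + b := by
  induction k with
  | zero =>
    intro r c
    constructor
    · intro h
      exact ⟨r, c, le_rfl, le_rfl, h, by omega⟩
    · rintro ⟨a, b, h1, h2, h3, -⟩
      exact lam.up_left_mem h1 h2 h3
  | succ k ih =>
    intro r c
    rw [Function.iterate_succ_apply', mem_eraseCorners]
    constructor
    · rintro ⟨h1, h2⟩
      have h3 : (r + 1, c) ∈ eraseCorners^[k] lam ∨ (r, c + 1) ∈ eraseCorners^[k] lam := by
        by_contra! h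
        exact h2 ⟨h1, h.1, h.2⟩
      rcases h3 with h3 | h3
      · obtain ⟨a, b, h4, h5, h6, h7⟩ := (ih _ _).1 h3
        exact ⟨a, b, by omega, h5, h6, by omega⟩
      · obtain ⟨a, b, h4, h5, h6, h7⟩ := (ih _ _).1 h3
        exact ⟨a, b, h4, by omega, h6, by omega⟩
    · rintro ⟨a, b, h1, h2, h3, h4⟩
      refine ⟨(ih _ _).2 ⟨a, b, h1, h2, h3, by omega⟩, ?_⟩
      rintro ⟨-, h5, h6⟩
      rcases Nat.lt_or_ge r a with h7 | h7
      · exact h5 ((ih _ _).2 ⟨a, b, h7, h2, h3, by omega⟩)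
      · exact h6 ((ih _ _).2 ⟨a, b, h1, by omega, h3, by omega⟩)

theorem isLevel_level (lam : YoungDiagram) {r c : ℕ} (h : c < lam.rowLen r) :
    IsLevel lam.rowLen r c (level lam (r, c)) := by
  classical
  have hex : ∃ k, (r, c) ∉ eraseCorners^[k] lam := by
    refine ⟨lam.colLen 0 + lam.rowLen 0, fun hm => ?_⟩
    obtain ⟨a, b, h1, h2, h3, h4⟩ := (mem_eraseCorners_iterate _ _ _ _).1 hm
    have h5 := YoungDiagram.mem_iff_lt_colLen.1 (lam.up_left_mem le_rfl (Nat.zero_le b) h3)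
    have h6 := YoungDiagram.mem_iff_lt_rowLen.1 (lam.up_left_mem (Nat.zero_le a) le_rfl h3)
    omega
  -- Nonemptiness matters: `level` is an infimum in `ℕ`, which would be `0` by default on the empty
  -- set.
  have hne : {k | IsCorner (eraseCorners^[k] lam) (r, c)}.Nonempty := by
    have h0 : Nat.find hex ≠ 0 := by
      intro h0
      have := Nat.find_spec hex
      rw [h0] at this
      exact this (YoungDiagram.mem_iff_lt_rowLen.2 h)
    obtain ⟨k, hk⟩ := Nat.exists_eq_succ_of_ne_zero h0
    refine ⟨k, ?_⟩
    have h1 : (r, c) ∈ eraseCorners^[k] lam := by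
      by_contra h1
      have := Nat.find_min' hex h1
      omega
    have h2 := Nat.find_spec hex
    rw [hk, Nat.succ_eq_add_one, Function.iterate_succ_apply', mem_eraseCorners] at h2
    by_contra h3
    exact h2 ⟨h1, h3⟩
  have hmem : IsCorner (eraseCorners^[level lam (r, c)] lam) (r, c) := Nat.sInf_mem hne
  set k := level lam (r, c)
  have h2 : (r, c) ∉ eraseCorners^[k + 1] lam := by
    rw [Function.iterate_succ_apply', mem_eraseCorners]
    exact fun h => h.2 hmem
  have hub : ∀ a, r ≤ a → c < lam.rowLen a → a + lam.rowLen a ≤ r + c + 1 + k := by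
    intro a h3 h4
    by_contra h5
    exact h2 ((mem_eraseCorners_iterate _ _ _ _).2 ⟨a, lam.rowLen a - 1, h3, by omega,
      YoungDiagram.mem_iff_lt_rowLen.2 (by omega), by omega⟩)
  obtain ⟨a, b, h3, h4, h5, h6⟩ := (mem_eraseCorners_iterate _ _ _ _).1 hmem.1
  have h7 := YoungDiagram.mem_iff_lt_rowLen.1 h5
  refine ⟨⟨a, h3, by omega, le_antisymm (hub a h3 (by omega)) (by omega)⟩, hub⟩

/-- The operators of a row of boxes with arbitrary levels. -/
def levelRow (s : ℤ) : ℕ → (ℕ → ℕ) → WordFun → WordFun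
  | 0, _, f => f
  | m + 1, l, f => tOp (s + m) (l m) (levelRow s m l f)

/-- The operators of the boxes of a diagram with row lengths `ρ` and levels `l`, row by row. -/
def levelRows : ℤ → ℕ → (ℕ → ℕ) → (ℕ → ℕ → ℕ) → WordFun → WordFun
  | _, 0, _, _, f => f
  | N, h + 1, ρ, l, f =>
    levelRows (N - 1) h (fun j => ρ (j + 1)) (fun j => l (j + 1)) (levelRow N (ρ 0) (l 0) f)

theorem levelRow_add (s : ℤ) (c m : ℕ) (l : ℕ → ℕ) (f : WordFun) :
    levelRow s (c + m) l f = levelRow (s + c) m (fun j => l (c + j)) (levelRow s c l f) := by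
  induction m with
  | zero => rfl
  | succ m ih =>
    rw [← add_assoc, levelRow, ih, levelRow]
    congr 2
    push_cast
    ring

theorem levelRow_eq_rowOp (s : ℤ) (c : ℕ) (f : WordFun) :
    ∀ (k : ℕ) (l : ℕ → ℕ), (∀ j, j < c → l j = k + (c - 1 - j)) →
      levelRow s c l f = rowOp s c k f := by
  induction c with
  | zero => intro k l _; rfl
  | succ c ih =>
    intro k l h
    rw [levelRow, rowOp, ih (k + 1) l fun j hj => by rw [h j (by omega)]; omega,
      h c (by omega)]
    simp

theorem levelRows_add (r m : ℕ) :
    ∀ (N : ℤ) (ρ : ℕ → ℕ) (l : ℕ → ℕ → ℕ) (f : WordFun), levelRows N (r + m) ρ l f =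
      levelRows (N - r) m (fun j => ρ (r + j)) (fun j => l (r + j)) (levelRows N r ρ l f) := by
  induction r with
  | zero => intro N ρ l f; simp [levelRows]
  | succ r ih =>
    intro N ρ l f
    rw [show r + 1 + m = (r + m) + 1 by ring, levelRows, ih, levelRows]
    have e : ∀ j, r + j + 1 = r + 1 + j := fun j => by ring
    simp only [e]
    congr 1
    push_cast
    ring

theorem levelRows_eq_of_zero (h : ℕ) :
    ∀ (N : ℤ) (ρ : ℕ → ℕ) (l : ℕ → ℕ → ℕ) (f : WordFun), (∀ j, ρ j = 0) →
      levelRows N h ρ l f = f := by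
  induction h with
  | zero => intro N ρ l f _; rfl
  | succ h ih =>
    intro N ρ l f hρ
    rw [levelRows, ih _ _ _ _ fun j => hρ _, hρ 0, levelRow]

theorem rect_levelRow_comm (N : ℤ) (r c m : ℕ) (s : ℤ) (l : ℕ → ℕ) (f : WordFun)
    (h : N + c < s) :
    rect N r c (levelRow s m l f) = levelRow s m l (rect N r c f) := by
  induction m with
  | zero => rfl
  | succ m ih =>
    rw [levelRow, levelRow, ← ih]
    have := rect_intertwine (tOp (s + m) (l m)) 0 r c N (levelRow s m l f)
      fun j _ _ => tOp_intertwine_of_lt _ (by omega)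
    rw [this, add_zero]

/-- The boxes of a row beyond column `c` commute with the rectangle boxes of all later rows, so the
whole rectangle can be applied first. -/
theorem levelRows_split (c r : ℕ) :
    ∀ (N : ℤ) (ρ : ℕ → ℕ) (l : ℕ → ℕ → ℕ) (f : WordFun), (∀ j, j < r → c ≤ ρ j) →
      (∀ i j, i < r → j < c → l i j = (r - 1 - i) + (c - 1 - j)) →
      levelRows N r ρ l f =
        levelRows (N + c) r (fun j => ρ j - c) (fun i j => l i (c + j)) (rect N r c f) := by
  induction r with
  | zero => intro N ρ l f _ _; rfl
  | succ r ih =>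
    intro N ρ l f hρ hl
    rw [levelRows, ih (N - 1) _ _ _ (fun j hj => hρ _ (by omega))
      (fun i j hi hj => by rw [hl _ _ (by omega) hj]; omega), levelRows, rect]
    obtain ⟨m, hm⟩ : ∃ m, ρ 0 = c + m := ⟨ρ 0 - c, by have := hρ 0 (by omega); omega⟩
    rw [hm, levelRow_add, levelRow_eq_rowOp N c f r (l 0) fun j hj => by
        rw [hl 0 j (by omega) hj]; omega,
      rect_levelRow_comm _ _ _ _ _ _ _ (by omega), Nat.add_sub_cancel_left]
    congr 1
    ring

/-- The operators of the boxes of a partition, and its boundary path, come from a tree. -/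
theorem exists_valleyTree (n : ℕ) :
    ∀ (h : ℕ) (ρ : ℕ → ℕ) (l : ℕ → ℕ → ℕ), h + ρ 0 ≤ n → Antitone ρ → (∀ j, h ≤ j → ρ j = 0) →
      (∀ i j, j < ρ i → IsLevel ρ i j (l i j)) →
      ∃ t : ValleyTree, t.Valid ∧ (∀ d, (∀ j, 0 < ρ j → j + ρ j ≤ d) → t.depth ≤ d) ∧
        (∀ N f, levelRows N h ρ l f = t.op N f) ∧
        ∀ (N q : ℤ), t.Up N q ↔ ∃ j : ℕ, q = N - j + ρ j := by
  induction n with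
  | zero =>
    intro h ρ l hn hρ hh _
    obtain rfl : h = 0 := by omega
    refine ⟨.leaf, trivial, fun d _ => Nat.zero_le _, fun N f => rfl, fun N q => ?_⟩
    rw [ValleyTree.Up]
    refine ⟨fun hq => ⟨(N - q).toNat, ?_⟩, ?_⟩
    · rw [hh _ (Nat.zero_le _)]
      push_cast
      omega
    · rintro ⟨j, rfl⟩
      rw [hh _ (Nat.zero_le _)]
      push_cast
      omega
  | succ n ih =>
    intro h ρ l hn hρ hh hl
    rcases Nat.eq_zero_or_pos (ρ 0) with h0 | h0
    · have hz : ∀ j, ρ j = 0 := fun j => by have := hρ (Nat.zero_le j); omega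
      refine ⟨.leaf, trivial, fun d _ => Nat.zero_le _,
        fun N f => levelRows_eq_of_zero h N ρ l f hz, fun N q => ?_⟩
      rw [ValleyTree.Up]
      refine ⟨fun hq => ⟨(N - q).toNat, ?_⟩, ?_⟩
      · rw [hz]
        push_cast
        omega
      · rintro ⟨j, rfl⟩
        rw [hz]
        push_cast
        omega
    have hlt : ∀ j, 0 < ρ j → j < h := by
      intro j hj
      by_contra hc
      have := hh j (by omega)
      omega
    -- Row `a` ends in a corner farthest from the first box, that is, a lowest valley of the path;
    -- ties may be broken arbitrarily.
    obtain ⟨a, ha, hmax⟩ := Finset.exists_max_image ((Finset.range h).filter fun j => 0 < ρ j)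
      (fun j => j + ρ j) ⟨0, by simpa using ⟨hlt 0 h0, h0⟩⟩
    simp only [Finset.mem_filter, Finset.mem_range] at ha hmax
    obtain ⟨hah, ha0⟩ := ha
    have hmax' : ∀ j, 0 < ρ j → j + ρ j ≤ a + ρ a := fun j hj => hmax j ⟨hlt j hj, hj⟩
    set c := ρ a with hc
    have hge : ∀ j, j < a + 1 → c ≤ ρ j := fun j hj => hρ (by omega)
    have hle : ∀ j, a ≤ j → ρ j ≤ c := fun j hj => hρ hj
    have hc0 : c ≤ ρ 0 := hge 0 (by omega)
    obtain ⟨R, R1, R2, R3, R4⟩ := ih (a + 1) (fun j => ρ j - c) (fun i j => l i (c + j))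
      (by omega) (fun i j hij => by have := hρ hij; simp only; omega)
      (fun j hj => by have := hle j (by omega); omega)
      (by
        intro i j hij
        obtain ⟨⟨b, b1, b2, b3⟩, b4⟩ := hl i (c + j) (by omega)
        unfold IsLevel
        beta_reduce
        refine ⟨⟨b, b1, by omega, by omega⟩, fun b b1 b2 => ?_⟩
        have := b4 b b1 (by omega)
        omega)
    obtain ⟨L, L1, L2, L3, L4⟩ := ih (h - (a + 1)) (fun j => ρ (a + 1 + j))
      (fun i => l (a + 1 + i)) (by have := hρ (Nat.zero_le (a + 1 + 0)); omega)
      (fun i j hij => hρ (by omega)) (fun j hj => hh _ (by omega))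
      (by
        intro i j hij
        obtain ⟨⟨b, b1, b2, b3⟩, b4⟩ := hl (a + 1 + i) j hij
        unfold IsLevel
        beta_reduce
        refine ⟨⟨b - (a + 1), by omega, ?_, ?_⟩, fun b b1 b2 => ?_⟩
        · rwa [show a + 1 + (b - (a + 1)) = b by omega]
        · rw [show a + 1 + (b - (a + 1)) = b by omega]
          omega
        · have := b4 (a + 1 + b) (by omega) b2
          omega)
    have hR : R.depth ≤ a := R2 a fun j hj => by
      have := hmax' j (by omega)
      omega
    have hL : L.depth ≤ c - 1 := L2 (c - 1) fun j hj => by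
      have := hmax' _ hj
      omega
    refine ⟨.node (a + 1) c L R, ⟨by omega, ha0, by omega, by omega, L1, R1⟩, fun d hd => ?_,
      fun N f => ?_, fun N q => ?_⟩
    · have := hd a ha0
      rw [ValleyTree.depth_node]
      omega
    · obtain ⟨m, rfl⟩ : ∃ m, h = a + 1 + m := ⟨h - (a + 1), by omega⟩
      rw [levelRows_add, levelRows_split c (a + 1) N ρ l f hge, R3, ValleyTree.op]
      · rw [← L3, Nat.add_sub_cancel_left]
      -- No box is farther than the chosen corner, and this corner lies weakly below and to the
      -- right of every box of the rectangle, so it determines the level.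
      · intro i j hi hj
        obtain ⟨⟨b, b1, b2, b3⟩, b4⟩ := hl i j (by have := hge i hi; omega)
        have e1 := b4 a (by omega) hj
        have e2 := hmax' b (by omega)
        omega
    · rw [ValleyTree.Up]
      split_ifs with hq
      · rw [L4]
        constructor
        · rintro ⟨j, rfl⟩
          exact ⟨a + 1 + j, by push_cast; ring⟩
        · rintro ⟨j, rfl⟩
          have hj : a + 1 ≤ j := by
            by_contra hj
            have := hge j (by omega)
            push_cast at hq
            omega
          obtain ⟨j, rfl⟩ := Nat.exists_eq_add_of_le hj
          exact ⟨j, by push_cast; ring⟩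
      · rw [R4]
        constructor
        · rintro ⟨j, rfl⟩
          have hj : j < a + 1 := by
            by_contra hj
            have := hle j (by omega)
            push_cast at hq
            omega
          have := hge j hj
          exact ⟨j, by omega⟩
        · rintro ⟨j, rfl⟩
          have hj : j < a + 1 := by
            by_contra hj
            rcases Nat.eq_zero_or_pos (ρ j) with h1 | h1
            · push_cast at hq
              omega
            · have := hmax' j h1
              push_cast at hq
              omega
          have := hge j hj
          exact ⟨j, by omega⟩

/-! ### Back to polynomials and diagrams -/

/-- The function of words given by a polynomial. -/
noncomputable def toFun (f : MvPolynomial ℕ ℚ) : WordFun :=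
  fun w => MvPolynomial.eval (fun p : ℕ => w p) f

theorem toFun_boxOperator (i k : ℕ) (f : MvPolynomial ℕ ℚ) :
    toFun (boxOperator i k f) = -tOp i k (toFun f) := by
  funext w
  have e : (fun p : ℕ => w p) ∘ Equiv.swap i (i + 1) =
      fun p : ℕ => (w ∘ Equiv.swap (i : ℤ) (i + 1)) p := by
    funext p
    simp only [Function.comp_apply, Equiv.swap_apply_def]
    split_ifs <;> first | rfl | omega
  simp only [toFun, boxOperator, map_sub, map_mul, MvPolynomial.eval_rename, MvPolynomial.eval_C,
    Pi.neg_apply, tOp_apply, e]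
  ring

theorem toFun_foldl_row (n i m : ℕ) (hi : i ≤ n) (l : ℕ × ℕ → ℕ) (f : MvPolynomial ℕ ℚ) :
    toFun (((List.range m).map fun j => (i, j)).foldl
        (fun f c => boxOperator (content n c) (l c) f) f) =
      (-1 : ℚ) ^ m • levelRow (n - i) m (fun j => l (i, j)) (toFun f) := by
  induction m with
  | zero => simp [levelRow]
  | succ m ih =>
    rw [List.range_succ, List.map_append, List.foldl_append, List.map_singleton, List.foldl_cons,
      List.foldl_nil, toFun_boxOperator, ih, map_smul, levelRow, pow_succ]
    -- The bound `i ≤ n` ensures that the subtraction in `content` is not truncated.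
    have e : ((content n (i, m) : ℕ) : ℤ) = n - i + m := by simp only [content]; omega
    rw [e, mul_neg, mul_one, neg_smul]

theorem levelRow_smul (s : ℤ) (m : ℕ) (l : ℕ → ℕ) (c : ℚ) (f : WordFun) :
    levelRow s m l (c • f) = c • levelRow s m l f := by
  induction m with
  | zero => rfl
  | succ m ih => rw [levelRow, ih, map_smul, levelRow]

theorem toFun_foldl_rows (n h : ℕ) (ρ : ℕ → ℕ) (l : ℕ × ℕ → ℕ) :
    ∀ (f : MvPolynomial ℕ ℚ), h ≤ n + 1 →
    toFun (((List.range h).flatMap fun i => (List.range (ρ i)).map fun j => (i, j)).foldl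
        (fun f c => boxOperator (content n c) (l c) f) f) =
      (-1 : ℚ) ^ (∑ i ∈ Finset.range h, ρ i) • levelRows n h ρ (fun i j => l (i, j)) (toFun f) := by
  induction h with
  | zero => intro f _; simp [levelRows]
  | succ h ih =>
    intro f hn
    rw [List.range_succ, List.flatMap_append, List.foldl_append, List.flatMap_singleton,
      toFun_foldl_row _ _ _ (by omega), ih f (by omega), levelRow_smul, smul_smul,
      Finset.sum_range_succ, pow_add, mul_comm, levelRows_add h 1]
    rfl

theorem card_eq_sum_rowLen (lam : YoungDiagram) :
    lam.card = ∑ i ∈ Finset.range (lam.colLen 0), lam.rowLen i := by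
  have : lam.cells =
      ((Finset.range (lam.colLen 0)).sigma fun i => Finset.range (lam.rowLen i)).map
        (Equiv.sigmaEquivProd ℕ ℕ).toEmbedding := by
    ext ⟨i, j⟩
    simp only [Finset.mem_map_equiv, Finset.mem_sigma, Finset.mem_range, YoungDiagram.mem_cells]
    change _ ↔ i < lam.colLen 0 ∧ j < lam.rowLen i
    rw [← YoungDiagram.mem_iff_lt_colLen, ← YoungDiagram.mem_iff_lt_rowLen]
    exact ⟨fun h => ⟨lam.up_left_mem le_rfl (Nat.zero_le j) h, h⟩, fun h => h.2⟩
  rw [YoungDiagram.card, this, Finset.card_map, Finset.card_sigma]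
  simp

theorem toFun_vandermonde (m : ℕ) : ∀ (a : ℕ) (w : ℤ → ℚ),
    toFun (vandermonde (a + 1) (a + m)) w = block (a + 1) m w := by
  induction m with
  | zero => intro a w; simp [toFun, vandermonde, block]
  | succ m ih =>
    intro a w
    have h1 := ih (a + 1) w
    rw [block_succ]
    push_cast at h1
    rw [← h1]
    simp only [toFun, vandermonde, map_prod, map_sub, MvPolynomial.eval_X]
    rw [show a + (m + 1) = a + 1 + m by ring,
      ← Finset.insert_Icc_add_one_left_eq_Icc (by omega : a + 1 ≤ a + 1 + m),
      Finset.prod_insert (by simp)]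
    congr 1
    rw [show Finset.Ioc (a + 1) (a + 1 + m) = (Finset.range m).image (fun j => a + 1 + 1 + j) by
      ext x
      simp only [Finset.mem_Ioc, Finset.mem_image, Finset.mem_range]
      exact ⟨fun h => ⟨x - (a + 2), by omega, by omega⟩, by rintro ⟨j, h1, rfl⟩; omega⟩]
    rw [Finset.prod_image (by intro x _ y _ h; simpa using h)]
    push_cast
    rfl

theorem toFun_start (n : ℕ) :
    toFun (vandermonde 1 n * vandermonde (n + 1) (2 * n)) = twoBlocks n := by
  funext w
  have h1 := toFun_vandermonde n 0 w
  have h2 := toFun_vandermonde n n w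
  rw [zero_add, zero_add] at h1
  rw [← two_mul] at h2
  rw [twoBlocks, ← h2]
  simp only [toFun, map_mul] at h1 ⊢
  rw [h1]
  simp

theorem evalAt_eq_toFun (v : List ℕ) (f : MvPolynomial ℕ ℚ) :
    evalAt v f = toFun f (wordOf v) := by
  rw [evalAt, toFun]
  congr 2
  funext p
  rw [wordOf]
  rcases Nat.eq_zero_or_pos p with rfl | h
  · simp
  · rw [if_neg (by omega), if_neg (by omega), Int.toNat_natCast]

theorem rowLen_staircase {n : ℕ} {lam : YoungDiagram} (h : lam ≤ staircase n) {j : ℕ}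
    (hj : 0 < lam.rowLen j) : j + lam.rowLen j ≤ n - 1 := by
  have h1 : (j, lam.rowLen j - 1) ∈ lam := YoungDiagram.mem_iff_lt_rowLen.2 (by omega)
  have h2 := h h1
  rw [staircase, ← YoungDiagram.mem_cells] at h2
  simp only [Finset.mem_filter] at h2
  omega

theorem colLen_le_of_le_staircase {n : ℕ} {lam : YoungDiagram} (h : lam ≤ staircase n) :
    lam.colLen 0 ≤ n := by
  by_contra hc
  have h1 : (n, 0) ∈ lam := YoungDiagram.mem_iff_lt_colLen.2 (by omega)
  have h2 := rowLen_staircase h (YoungDiagram.mem_iff_lt_rowLen.1 h1)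
  have := YoungDiagram.mem_iff_lt_rowLen.1 h1
  omega

theorem exists_tree_of_le_staircase {n : ℕ} {lam : YoungDiagram} (h : lam ≤ staircase n) :
    ∃ t : ValleyTree, t.Valid ∧ t.depth ≤ n - 1 ∧
      toFun (KLDelta n lam) = (-1 : ℚ) ^ lam.card • t.op n (twoBlocks n) ∧
      ∀ q, t.Up n q ↔ ∃ j : ℕ, q = n - j + lam.rowLen j := by
  obtain ⟨t, t1, t2, t3, t4⟩ := exists_valleyTree _ (lam.colLen 0) lam.rowLen
    (fun i j => level lam (i, j)) le_rfl (fun i j hij => lam.rowLen_anti i j hij)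
    (by
      intro j hj
      by_contra hc
      have h1 : (j, 0) ∈ lam := YoungDiagram.mem_iff_lt_rowLen.2 (by omega)
      have := YoungDiagram.mem_iff_lt_colLen.1 h1
      omega)
    (fun i j hij => isLevel_level lam hij)
  refine ⟨t, t1, t2 _ fun j hj => rowLen_staircase h hj, ?_, t4 n⟩
  have := colLen_le_of_le_staircase h
  rw [KLDelta, rowReading, toFun_foldl_rows n _ _ (level lam) _ (by omega), toFun_start, t3,
    card_eq_sum_rowLen]

theorem dyckPath_eq_pathList {n : ℕ} {lam : YoungDiagram} (h : lam ≤ staircase n)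
    {M : ℤ → Prop} (hM : ∀ q, M q ↔ ∃ j : ℕ, q = n - j + lam.rowLen j) :
    dyckPath n lam = pathList M n := by
  classical
  rw [dyckPath, pathList]
  refine List.map_congr_left fun k _ => if_congr (Iff.trans ?_ (hM _).symm) rfl rfl
  rw [upPositions, Finset.mem_image]
  constructor
  · rintro ⟨i, hi, hk⟩
    rw [Finset.mem_Icc] at hi
    exact ⟨n - i, by omega⟩
  · rintro ⟨j, hj⟩
    -- A row `j ≥ n` is empty and would give a position at most `0`.
    have hjn : j < n := by
      by_contra hc
      have h1 : lam.rowLen j = 0 := by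
        by_contra h1
        have := rowLen_staircase h (Nat.pos_of_ne_zero h1)
        omega
      omega
    exact ⟨n - j, Finset.mem_Icc.2 ⟨by omega, by omega⟩, by
      rw [show n - (n - j) = j by omega]; omega⟩

theorem eq_of_rowLen_eq {lam mu : YoungDiagram} (h : lam.rowLen = mu.rowLen) : lam = mu := by
  ext ⟨i, j⟩
  rw [YoungDiagram.mem_cells, YoungDiagram.mem_cells, YoungDiagram.mem_iff_lt_rowLen,
    YoungDiagram.mem_iff_lt_rowLen, h]

/-- The positions are strictly decreasing in the row index, so their set determines the sequence of
row lengths. -/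
theorem eq_of_path_eq {n : ℤ} {lam mu : YoungDiagram}
    (h : ∀ q : ℤ, (∃ j : ℕ, q = n - j + lam.rowLen j) ↔ ∃ j : ℕ, q = n - j + mu.rowLen j) :
    lam = mu := by
  have mono : ∀ nu : YoungDiagram, StrictMono fun j : ℕ => (j : ℤ) - nu.rowLen j := by
    intro nu i j hij
    have := nu.rowLen_anti i j hij.le
    beta_reduce
    omega
  have hr : Set.range (fun j : ℕ => (j : ℤ) - lam.rowLen j) =
      Set.range (fun j : ℕ => (j : ℤ) - mu.rowLen j) := by
    ext q
    constructor
    · rintro ⟨j, rfl⟩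
      obtain ⟨i, hi⟩ := (h (n - (j - lam.rowLen j))).1 ⟨j, by ring⟩
      exact ⟨i, by beta_reduce; omega⟩
    · rintro ⟨j, rfl⟩
      obtain ⟨i, hi⟩ := (h (n - (j - mu.rowLen j))).2 ⟨j, by ring⟩
      exact ⟨i, by beta_reduce; omega⟩
  have := (StrictMono.range_inj (mono lam) (mono mu)).1 hr
  apply eq_of_rowLen_eq
  funext j
  have := congrFun this j
  beta_reduce at this
  omega

theorem card_staircase_succ (n : ℕ) : (staircase (n + 1)).card = (staircase n).card + n := by
  have e : (staircase (n + 1)).cells =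
      (staircase n).cells ∪ (Finset.range n).image fun i => (i, n - 1 - i) := by
    ext ⟨i, j⟩
    simp only [staircase, Finset.mem_filter, Finset.mem_product, Finset.mem_range, Finset.mem_union,
      Finset.mem_image, Prod.mk.injEq]
    constructor
    · intro h
      rcases Nat.lt_or_ge (i + j + 1) n with h1 | h1
      · left; omega
      · right; exact ⟨i, by omega, rfl, by omega⟩
    · rintro (h | ⟨k, h1, rfl, rfl⟩) <;> omega
  rw [YoungDiagram.card, e, Finset.card_union_of_disjoint, Finset.card_image_of_injective _
    fun i j h => (Prod.mk.inj h).1, Finset.card_range]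
  rw [Finset.disjoint_left]
  rintro ⟨i, j⟩ h1 h2
  simp only [staircase, Finset.mem_filter, Finset.mem_image, Finset.mem_range, Prod.mk.injEq]
    at h1 h2
  omega

theorem constC_succ (n : ℕ) :
    constC (n + 1) = constC n * (∏ b ∈ Finset.range n, (2 * (b : ℚ) - 2 * n)) ^ 2 := by
  have e : ∀ i ∈ Finset.Icc 1 n, ∏ j ∈ Finset.Ioc i (n + 1), (2 * (i : ℚ) - 2 * (j : ℚ)) ^ 2 =
      (∏ j ∈ Finset.Ioc i n, (2 * (i : ℚ) - 2 * (j : ℚ)) ^ 2) *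
        (2 * (i : ℚ) - 2 * ((n + 1 : ℕ) : ℚ)) ^ 2 := by
    intro i hi
    rw [Finset.mem_Icc] at hi
    rw [← Finset.insert_Ioc_right_eq_Ioc_add_one (by omega), Finset.prod_insert (by simp), mul_comm]
  rw [constC, Finset.prod_Icc_succ_top (by omega), Finset.prod_congr rfl e, Finset.prod_mul_distrib,
    Finset.Ioc_self, Finset.prod_empty, mul_one, constC, ← Finset.prod_pow]
  congr 1
  rw [show Finset.Icc 1 n = (Finset.range n).image (· + 1) by
    ext x
    simp only [Finset.mem_Icc, Finset.mem_image, Finset.mem_range]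
    exact ⟨fun h => ⟨x - 1, by omega, by omega⟩, by rintro ⟨j, h1, rfl⟩; omega⟩]
  rw [Finset.prod_image (by intro x _ y _ h; simpa using h)]
  refine Finset.prod_congr rfl fun b _ => ?_
  push_cast
  ring

/-- Adding the label `2 * n` contributes the sign `(-1) ^ n`, and passing to the next staircase adds
`n` boxes. -/
theorem diffProd_even (n : ℕ) :
    diffProd ((List.range' 0 n).map (2 * ·)).toFinset =
      (-1) ^ (staircase n).card * constC n := by
  have e : ∀ m, ((List.range' 0 m).map (2 * ·)).toFinset = (Finset.range m).image (2 * ·) := by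
    intro m
    ext x
    simp [List.mem_range']
  simp only [e]
  induction n with
  | zero => simp [diffProd, constC, staircase, YoungDiagram.card]
  | succ n ih =>
    have inj : ∀ s : Set ℕ, Set.InjOn (fun x : ℕ => 2 * x) s := fun s x _ y _ h => by
      beta_reduce at h; omega
    rw [Finset.range_add_one, Finset.image_insert, diffProd_insert (by simp), ih,
      Finset.card_image_of_injOn (inj _), Finset.card_range, Finset.prod_image (inj _), constC_succ,
      card_staircase_succ, pow_add]
    push_cast
    ring

end KLInterp

theorem mainTheorem8 (n : ℕ) (lam mu : YoungDiagram)
    (hlam : lam ≤ KLInterp.staircase n) (hmu : mu ≤ KLInterp.staircase n) :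
    KLInterp.evalAt (KLInterp.psi n mu) (KLInterp.KLDelta n lam) =
      (-1 : ℚ) ^ (((KLInterp.staircase n).card : ℤ) - (lam.card : ℤ)) * KLInterp.constC n *
        KLInterp.delta lam mu := by
  classical
  obtain ⟨s, s1, s2, s3, s4⟩ := KLInterp.exists_tree_of_le_staircase hlam
  obtain ⟨t, t1, t2, -, t4⟩ := KLInterp.exists_tree_of_le_staircase hmu
  obtain ⟨hcount, hval⟩ := KLInterp.ValleyTree.value n s t s1 t1 s2 t2
  obtain ⟨-, -, h⟩ := hval ((List.range' 0 n).map (2 * ·))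
    (List.Nodup.map (fun x y h => by omega) List.nodup_range') (by simp)
  have hiff : s.Up n = t.Up n ↔ lam = mu := by
    constructor
    · intro e
      refine KLInterp.eq_of_path_eq (n := n) fun q => ?_
      rw [← s4, ← t4, e]
    · rintro rfl
      funext q
      rw [propext (s4 q), propext (t4 q)]
  rw [KLInterp.evalAt_eq_toFun, s3, Pi.smul_apply, KLInterp.psi,
    KLInterp.dyckPath_eq_pathList hmu t4, KLInterp.labelSteps_eq_labelFrom _ 0 n [] hcount.le, h,
    KLInterp.diffProd_even, KLInterp.delta, zpow_sub₀ (by norm_num), zpow_natCast, zpow_natCast,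
    smul_eq_mul]
  -- The sign `(-1) ^ lam.card` comes from replacing each box operator by its negative; it equals
  -- its inverse, which turns it into the sign of the difference.
  have hsq : ((-1 : ℚ) ^ lam.card)⁻¹ = (-1) ^ lam.card := by
    rw [← inv_pow]; norm_num
  rw [div_eq_mul_inv, hsq, if_congr hiff rfl rfl]
  ring
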